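/- Let $G$ be a regular Lie group (finite- or infinite-dimensional, modelled on $c^\infty$-open subsets of a convenient vector space, in the sense of Kriegl and Michor) with Lie algebra $\mathfrak g$. For a smooth curve $\gamma:[0,1]\to G$ let $u=\kappa^\ell(\dot\gamma)$, $u(t)=d\ell_{\gamma(t)^{-1}}\dot\gamma(t)\in\mathfrak g$, be its left logarithmic derivative. Let $\langle\cdot,\cdot\rangle$ be a (smooth, positive definite) inner product on $\mathfrak g$ such that for every $x\in\mathfrak g$ the adjoint $\mathrm{ad}_x^\top$ of $\mathrm{ad}_x=[x,\cdot\,]$ exists, i.e. $\langle \mathrm{ad}_x^\top w,y\rangle=\langle w,[x,y]\rangle$ for all $w,y\in\mathfrak g$, and let $\mathbf g$ be the corresponding left-invariant metric on $G$. Let $K$ be a connected (regular) Lie subgroup of $G$ with Lie algebra $\mathfrak k$, put $\mathfrak h=\mathfrak k^\perp$, and assume that $\mathfrak g=\mathfrak h\oplus\mathfrak k$ and that $\langle\cdot,\cdot\rangle$ is $\mathrm{Ad}(K)$-invariant; let $\mathrm{pr}_{\mathfrak k}$ be the orthogonal projection onto $\mathfrak k$. A smooth curve on $[0,1]$ is a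 Riemannian geodesic if it is a critical point of $E(\gamma)=\frac12\int_0^1\mathbf g(\dot\gamma,\dot\gamma)\,dt$ with respect to all smooth variations with fixed end points. A smooth curve $\gamma:[0,1]\to G$ with left logarithmic derivative $u$ is a normal sub-Riemannian geodesic (for the left-invariant structure defined by $\mathfrak h$ and $\langle\cdot,\cdot\rangle|_{\mathfrak h}$) if $u(t)\in\mathfrak h$ for all $t$ and $\int_0^1\langle u,\dot x+[u,x]\rangle\,dt=0$ for every smooth $x:[0,1]\to\mathfrak g$ with $x(0)=x(1)=0$ such that $\dot x+[u,x]$ takes values in $\mathfrak h$. Let $\gamma_R:[0,1]\to G$ be a Riemannian geodesic, let $\lambda=\mathrm{pr}_{\mathfrak k}\,\kappa^\ell(\dot\gamma_R(0))\in\mathfrak k$, and let $$\gamma_{sR}(t)=\gamma_R(t)\cdot\exp_G(-\lambda t),\qquad t\in[0,1].$$ Then $\gamma_{sR}$ is a normal sub-Riemannian geodesic, and its left logarithmic derivative $u_{sR}$ satisfies $$\dot u_{sR}(t)=\mathrm{ad}_{u_{sR}(t)}^\top\bigl(u_{sR}(t)+\lambda\bigr),\qquad t\in[0,1],$$ with this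 constant $\lambda\in\mathfrak k$. -/

import Mathlib

open Set Filter Topology
open scoped ContDiff

namespace ConvLie

/-! ## Calculus of curves in topological vector spaces -/

section Curves

variable {E : Type*} [AddCommGroup E] [Module ℝ E] [TopologicalSpace E]

/-- `v` is the derivative of the curve `c` at `t`: the limit of the difference quotients
`(s - t)⁻¹ • (c s - c t)` as `s → t`, `s ≠ t`. -/
def HasVelocityAt (c : ℝ → E) (v : E) (t : ℝ) : Prop :=
  Tendsto (slope c t) (𝓝[≠] t) (𝓝 v)

/-- The derivative of the curve `c` at `t` (meaningful when it exists). -/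
noncomputable def velocity (c : ℝ → E) (t : ℝ) : E :=
  limUnder (𝓝[≠] t) (slope c t)

/-- The curve `c` is smooth on the open set `J ⊆ ℝ`: all its iterated derivatives exist there. -/
def SmoothCurveOn (c : ℝ → E) (J : Set ℝ) : Prop :=
  ∃ d : ℕ → ℝ → E, d 0 = c ∧ ∀ n, ∀ t ∈ J, HasVelocityAt (d n) (d (n + 1) t) t

/-- The curve `c : ℝ → E` is smooth. -/
def SmoothCurve (c : ℝ → E) : Prop := SmoothCurveOn c univ

/-- `U` is `c^∞`-open: its preimage under every smooth curve is open. -/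
def CInftyOpen (U : Set E) : Prop :=
  ∀ c : ℝ → E, SmoothCurve c → IsOpen (c ⁻¹' U)

end Curves

/-- For curves in normed spaces, `HasVelocityAt` is the usual derivative. -/
theorem hasVelocityAt_iff_hasDerivAt {E : Type*} [NormedAddCommGroup E] [NormedSpace ℝ E]
    {c : ℝ → E} {v : E} {t : ℝ} : HasVelocityAt c v t ↔ HasDerivAt c v t :=
  hasDerivAt_iff_tendsto_slope.symm

/-- A convenient vector space: a Hausdorff locally convex real vector space which is
`c^∞`-complete, i.e. every scalarwise smooth curve is smooth. -/
class ConvenientSpace (E : Type*) [AddCommGroup E] [Module ℝ E] [TopologicalSpace E] : Prop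
    extends IsTopologicalAddGroup E, ContinuousSMul ℝ E, LocallyConvexSpace ℝ E, T2Space E where
  smooth_of_scalarwise : ∀ c : ℝ → E,
    (∀ l : E →L[ℝ] ℝ, ContDiff ℝ ∞ (fun t => l (c t))) → SmoothCurve c

/-! ## Manifolds and Lie groups modelled on convenient vector spaces -/

/-- A smooth manifold modelled on `c^∞`-open subsets of the convenient vector space `E`: a set `M`
with an atlas of bijections between subsets of `M` and subsets of `E`, the chart changes being
smooth (they map smooth curves to smooth curves) with `c^∞`-open domains. (For `φ = ψ` this says
that the image of a chart is `c^∞`-open.) A chart around each point is singled out. -/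
class ConvenientManifold (E : Type*) [AddCommGroup E] [Module ℝ E] [TopologicalSpace E]
    (M : Type*) where
  atlas : Set (PartialEquiv M E)
  chartAt : M → PartialEquiv M E
  chartAt_mem : ∀ x, chartAt x ∈ atlas
  mem_chartAt_source : ∀ x, x ∈ (chartAt x).source
  open_overlap : ∀ φ ∈ atlas, ∀ ψ ∈ atlas, CInftyOpen (φ '' (φ.source ∩ ψ.source))
  smooth_change : ∀ φ ∈ atlas, ∀ ψ ∈ atlas, ∀ c : ℝ → E, SmoothCurve c →
    (∀ t, c t ∈ φ '' (φ.source ∩ ψ.source)) → SmoothCurve (fun t => ψ (φ.symm (c t)))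

section Manifolds

variable (E : Type*) [AddCommGroup E] [Module ℝ E] [TopologicalSpace E]

/-- A smooth curve in a manifold: locally it stays in a chart domain and is smooth in the chart. -/
def MSmoothCurve {M : Type*} [ConvenientManifold E M] (c : ℝ → M) : Prop :=
  ∀ t : ℝ, ∃ φ ∈ ConvenientManifold.atlas (E := E) (M := M), ∃ J : Set ℝ,
    IsOpen J ∧ t ∈ J ∧ (∀ s ∈ J, c s ∈ φ.source) ∧ SmoothCurveOn (fun s => φ (c s)) J

/-- A Lie group modelled on `E`. Multiplication and inversion are smooth, i.e. they map smooth
curves to smooth curves (a smooth curve in `G × G` is a pair of smooth curves in `G`). -/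
class ConvenientLieGroup (G : Type*) [Group G] extends ConvenientManifold E G where
  smooth_mul : ∀ c d : ℝ → G, MSmoothCurve E c → MSmoothCurve E d →
    MSmoothCurve E (fun t => c t * d t)
  smooth_inv : ∀ c : ℝ → G, MSmoothCurve E c → MSmoothCurve E (fun t => (c t)⁻¹)

end Manifolds

section LieGroups

variable (E : Type*) [AddCommGroup E] [Module ℝ E] [TopologicalSpace E]
  {G : Type*} [Group G] [ConvenientLieGroup E G]

variable (G) in
/-- The chosen chart around `1`. It identifies the Lie algebra `T₁G` with the model space `E`:
the tangent vector at `1` of a smooth curve `c` through `1` is the derivative of `chartOne ∘ c`. -/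
def chartOne : PartialEquiv G E := ConvenientManifold.chartAt (1 : G)

variable (G) in
/-- A curve through `1` with velocity `x` at time `0`, affine in the chart `chartOne`
(only small times matter). -/
def lineOne (x : E) (s : ℝ) : G := (chartOne E G).symm (chartOne E G 1 + s • x)

/-- The left logarithmic derivative `u(t) = κˡ(γ'(t))` of a curve `γ` in `G`, where
`κˡ(v) = dℓ_{a⁻¹} v` for `v ∈ T_a G` is the left Maurer-Cartan form: `u(t)` is the tangent vector
at `s = t` of the curve `s ↦ γ(t)⁻¹ γ(s)`. -/
noncomputable def logDeriv (γ : ℝ → G) (t : ℝ) : E :=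
  velocity (fun s => chartOne E G ((γ t)⁻¹ * γ s)) t

/-- The adjoint action `Ad_a : 𝔤 → 𝔤`, the tangent map at `1` of `b ↦ a b a⁻¹`. -/
noncomputable def Ad (a : G) (y : E) : E :=
  velocity (fun s => chartOne E G (a * lineOne E G y s * a⁻¹)) 0

variable (G) in
/-- The Lie bracket `[x, y] = ad_x y` of `𝔤`, where `ad` is the tangent map at `1` of
`a ↦ Ad_a y`. -/
noncomputable def lieBr (x y : E) : E :=
  velocity (fun s => Ad E (lineOne E G x s) y) 0

variable (G) in
/-- Regular Lie groups. Every smooth curve in the Lie algebra is the left logarithmic derivative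
of a smooth curve starting at `1`, and the map `C^∞(ℝ, 𝔤) → G`, `u ↦ γ(1)` is smooth. Here smooth
curves `r ↦ U r` in `C^∞(ℝ, 𝔤)` are the smooth maps `ℝ × ℝ → 𝔤`, `(r, t) ↦ U r t`. -/
class RegularLieGroup : Prop where
  exists_curve : ∀ u : ℝ → E, SmoothCurve u →
    ∃ γ : ℝ → G, MSmoothCurve E γ ∧ γ 0 = 1 ∧ ∀ t, logDeriv E γ t = u t
  smooth_evol : ∀ (U : ℝ → ℝ → E) (γ : ℝ → ℝ → G),
    (∀ a b : ℝ → ℝ, ContDiff ℝ ∞ a → ContDiff ℝ ∞ b → SmoothCurve (fun r => U (a r) (b r))) →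
    (∀ r, MSmoothCurve E (γ r) ∧ γ r 0 = 1 ∧ ∀ t, logDeriv E (γ r) t = U r t) →
    MSmoothCurve E (fun r => γ r 1)

open Classical in
/-- The exponential map of `G`: `exp x = γ(1)`, where `γ` is the smooth curve starting at `1` with
constant left logarithmic derivative `x`. (It exists whenever `G` is regular.) -/
noncomputable def expG (x : E) : G :=
  if h : ∃ γ : ℝ → G, MSmoothCurve E γ ∧ γ 0 = 1 ∧ ∀ t, logDeriv E γ t = x
  then h.choose 1 else 1

end LieGroups

/-! ## Subgroups -/

section Subgroups

/-- A Lie group is connected. (A manifold is connected iff any two points are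
joined by a smooth curve.) -/
def SmoothlyConnected (F : Type*) [AddCommGroup F] [Module ℝ F] [TopologicalSpace F]
    (K : Type*) [ConvenientManifold F K] : Prop :=
  ∀ a b : K, ∃ c : ℝ → K, MSmoothCurve F c ∧ c 0 = a ∧ c 1 = b

/-- `ι` makes the Lie group `K` a Lie subgroup of `G`: it is an injective smooth homomorphism. -/
structure IsLieSubgroup (E : Type*) [AddCommGroup E] [Module ℝ E] [TopologicalSpace E]
    (F : Type*) [AddCommGroup F] [Module ℝ F] [TopologicalSpace F]
    {G : Type*} [Group G] [ConvenientLieGroup E G] {K : Type*} [Group K] [ConvenientLieGroup F K]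
    (ι : K →* G) : Prop where
  injective : Function.Injective ι
  smooth : ∀ c : ℝ → K, MSmoothCurve F c → MSmoothCurve E (fun t => ι (c t))

/-- The tangent map at `1` of `ι : K → G`, a map from the Lie algebra of `K` to that of `G`. -/
noncomputable def tangentOne (E : Type*) [AddCommGroup E] [Module ℝ E] [TopologicalSpace E]
    (F : Type*) [AddCommGroup F] [Module ℝ F] [TopologicalSpace F]
    {G : Type*} [Group G] [ConvenientLieGroup E G] {K : Type*} [Group K] [ConvenientLieGroup F K]
    (ι : K →* G) (y : F) : E :=
  velocity (fun s => chartOne E G (ι (lineOne F K y s))) 0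

end Subgroups

/-! ## Left-invariant metrics and geodesics -/

section Geodesics

variable {E : Type*} [AddCommGroup E] [Module ℝ E] [TopologicalSpace E]

/-- `B` is an inner product on `E`: symmetric, positive definite, and smooth (equivalently
bounded), so that its left translates form a smooth Riemannian metric. -/
structure IsInner (B : LinearMap.BilinForm ℝ E) : Prop where
  symm : ∀ x y, B x y = B y x
  pos : ∀ x, x ≠ 0 → 0 < B x x
  smooth : ∀ c d : ℝ → E, SmoothCurve c → SmoothCurve d → ContDiff ℝ ∞ (fun t => B (c t) (d t))

variable {G : Type*} [Group G] [ConvenientLieGroup E G]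

/-- The energy `½ ∫₀¹ 𝐠(γ', γ') dt` for the left-invariant metric `𝐠` given by `B`. -/
noncomputable def energy (B : LinearMap.BilinForm ℝ E) (γ : ℝ → G) : ℝ :=
  (1 / 2) * ∫ t in (0 : ℝ)..1, B (logDeriv E γ t) (logDeriv E γ t)

variable (E) in
/-- `V t s = γ^s(t)`, `|s| < ε`, is a smooth variation of `γ` with fixed end points.
A map on `[0,1] × (-ε, ε)` is smooth if it extends to a smooth map on `ℝ × (-ε, ε)`. -/
structure IsVariation (γ : ℝ → G) (ε : ℝ) (V : ℝ → ℝ → G) : Prop where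
  smooth : ∀ a b : ℝ → ℝ, ContDiff ℝ ∞ a → ContDiff ℝ ∞ b → (∀ r, |b r| < ε) →
    MSmoothCurve E (fun r => V (a r) (b r))
  base : ∀ t ∈ Icc (0 : ℝ) 1, V t 0 = γ t
  left : ∀ s, |s| < ε → V 0 s = γ 0
  right : ∀ s, |s| < ε → V 1 s = γ 1

/-- `γ|_{[0,1]}` is a Riemannian geodesic: a critical point of the energy among the smooth curves
with the same end points. A curve on `[0,1]` is smooth if it extends to a smooth curve on `ℝ`;
the behaviour of `γ` outside `[0,1]` is irrelevant. -/
structure IsRiemannianGeodesic (B : LinearMap.BilinForm ℝ E) (γ : ℝ → G) : Prop where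
  smooth : MSmoothCurve E γ
  critical : ∀ ε > 0, ∀ V : ℝ → ℝ → G, IsVariation E γ ε V →
    HasDerivAt (fun s => energy B (fun t => V t s)) 0 0

variable (G) in
/-- `τ_u x = x' + [u, x]`. -/
noncomputable def tau (u x : ℝ → E) (t : ℝ) : E := velocity x t + lieBr E G (u t) (x t)

/-- `γ|_{[0,1]}` is a normal sub-Riemannian geodesic for the left-invariant structure given by the
subspace `𝔥 ⊆ 𝔤` and the restriction of `B` to `𝔥`: it is horizontal, and its left logarithmic
derivative is `L²`-orthogonal to `τ_u x` for every smooth `x : [0,1] → 𝔤` which vanishes at both end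
points and for which `τ_u x` takes values in `𝔥`. -/
structure IsNormalGeodesic (B : LinearMap.BilinForm ℝ E) (𝔥 : Submodule ℝ E) (γ : ℝ → G) :
    Prop where
  smooth : MSmoothCurve E γ
  horizontal : ∀ t ∈ Icc (0 : ℝ) 1, logDeriv E γ t ∈ 𝔥
  orthogonal : ∀ x : ℝ → E, SmoothCurve x → x 0 = 0 → x 1 = 0 →
    (∀ t ∈ Icc (0 : ℝ) 1, tau G (logDeriv E γ) x t ∈ 𝔥) →
    ∫ t in (0 : ℝ)..1, B (logDeriv E γ t) (tau G (logDeriv E γ) x t) = 0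

end Geodesics

end ConvLie

set_option linter.unusedSectionVars false

/-! Let u_R be the left logarithmic derivative of the Riemannian geodesic. Variations γ_R(t) σ(s
χ(t)) give the weak Euler–Arnold equation ⟨u_R', y⟩ = ⟨u_R, [u_R, y]⟩
(`IsRiemannianGeodesic.euler_arnold`). For y ∈ 𝔨 the right side vanishes, because Ad(K)-invariance
makes ad_y skew (`lieBr_skew`). Hence the 𝔨-component of u_R is the constant λ, a Noether
conservation law (`IsRiemannianGeodesic.momentum_const`).

Put k(t) = exp(tλ). Since Ad_{k(t)} λ = λ, the curve γ_R(t) k(-t) has logarithmic derivative u =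
Ad_{k(t)}(u_R − λ). This is horizontal, because Ad(K) preserves both 𝔨 and the inner product, and u
+ λ = Ad_{k(t)} u_R. Differentiating ⟨u + λ, y⟩ = ⟨u_R, Ad_{k(-t)} y⟩ yields ⟨u', y⟩ = ⟨u + λ, [u,
y]⟩. If τ = x' + [u, x] is horizontal, then ⟨u, τ⟩ = ⟨u + λ, τ⟩ = (d/dt)⟨u + λ, x⟩, whose integral
vanishes with x at the end points.

Most of the work is analytic. Smoothness here only means that smooth curves go to smooth curves,
while the chain rule, the antisymmetry of the bracket and the first variation of the energy need
genuine calculus in two parameters. These arguments are reduced to real functions on ℝ², which are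
smooth in the usual sense by Boman's theorem (`contDiffOn_of_smooth_along_curves`). That theorem is
proved from the special curve lemma and decay of the Fourier transform. -/

namespace ConvLie

/-! ### Special curves, cutoffs, and openness tested along curves. -/

section SpecialCurves

/-- One constant for all orders up to n is what normalises the n-th bump of the special curve; the
bound M ≥ 1 lets division by M only shrink. -/
theorem exists_bound_iteratedFDeriv {A : ℝ → ℝ} (hA : ContDiff ℝ ∞ A) (hc : HasCompactSupport A)
    (n : ℕ) : ∃ M : ℝ, 1 ≤ M ∧ ∀ k ≤ n, ∀ t, ‖iteratedFDeriv ℝ k A t‖ ≤ M := by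
  have h : ∀ k : ℕ, ∃ C : ℝ, ∀ t, ‖iteratedFDeriv ℝ k A t‖ ≤ C := fun k =>
    (hc.iteratedFDeriv (𝕜 := ℝ) k).exists_bound_of_continuous
      (hA.continuous_iteratedFDeriv (by exact_mod_cast le_top))
  choose C hC using h
  refine ⟨1 + ∑ k ∈ Finset.range (n + 1), |C k|, ?_, fun k hk t => ?_⟩
  · have : 0 ≤ ∑ k ∈ Finset.range (n + 1), |C k| := Finset.sum_nonneg fun _ _ => abs_nonneg _
    linarith
  · have h1 : |C k| ≤ ∑ k ∈ Finset.range (n + 1), |C k| :=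
      Finset.single_le_sum (f := fun k => |C k|) (fun _ _ => abs_nonneg _)
        (Finset.mem_range.2 (by omega))
    linarith [hC k t, le_abs_self (C k)]

variable {V : Type*} [NormedAddCommGroup V] [NormedSpace ℝ V]

theorem norm_iteratedFDeriv_smul_const_le {A : ℝ → ℝ} (hA : ContDiff ℝ ∞ A) (z : V) (k : ℕ)
    (t : ℝ) : ‖iteratedFDeriv ℝ k (fun t => A t • z) t‖ ≤ ‖z‖ * ‖iteratedFDeriv ℝ k A t‖ := by
  have := ContinuousLinearMap.norm_iteratedFDeriv_comp_left (𝕜 := ℝ)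
    (ContinuousLinearMap.toSpanSingleton ℝ z) (f := A) (x := t) (n := k) (N := ∞) hA.contDiffAt
    (by exact_mod_cast le_top)
  rw [ContinuousLinearMap.norm_toSpanSingleton] at this
  exact this

/-- The special curve lemma: a sequence that converges to `0` fast enough is visited, with
prescribed velocities that are small multiples of `v`, by a smooth curve in finite time. -/
theorem exists_special_curve [CompleteSpace V] (v : V) :
    ∃ δ ε τ : ℕ → ℝ, (∀ n, 0 < δ n) ∧ (∀ n, 0 < ε n) ∧ Tendsto δ atTop (𝓝 0) ∧
      Tendsto τ atTop (𝓝 0) ∧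
      ∀ z : ℕ → V, (∀ n, ‖z n‖ ≤ δ n) → ∃ c : ℝ → V, ContDiff ℝ ∞ c ∧ c 0 = 0 ∧
        ∀ n, ∀ᶠ t in 𝓝 (τ n), c t = z n + (ε n * (t - τ n)) • v := by
  -- The times halve, so bumps of radius `τ n / 4` around `τ n` have disjoint supports: near `τ n`
  -- only the n-th term of the series survives.
  let τ : ℕ → ℝ := fun n => (1 / 2) ^ n
  have hτ : ∀ n, 0 < τ n := fun n => by positivity
  have hτ2 : ∀ n, τ (n + 1) = τ n / 2 := fun n => by simp only [τ, pow_succ]; ring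
  have hτm : ∀ m n, n < m → τ m ≤ τ n / 2 := by
    intro m n h
    rw [← hτ2 n]
    exact pow_le_pow_of_le_one (by norm_num) (by norm_num) h
  let b : ∀ n, ContDiffBump (τ n) := fun n =>
    ⟨τ n / 8, τ n / 4, by have := hτ n; positivity, by have := hτ n; linarith⟩
  have hb0 : ∀ n t, τ n / 4 ≤ |t - τ n| → b n t = 0 := fun n t h =>
    (b n).zero_of_le_dist (by rw [Real.dist_eq]; exact h)
  let D : ℕ → ℝ → ℝ := fun n t => b n t * (t - τ n)
  have hbs : ∀ n, ContDiff ℝ ∞ (b n) := fun n => (b n).contDiff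
  have hDs : ∀ n, ContDiff ℝ ∞ (D n) := fun n => (hbs n).mul (contDiff_id.sub contDiff_const)
  choose M1 hM1 hM1' using fun n =>
    exists_bound_iteratedFDeriv (hbs n) (b n).hasCompactSupport n
  choose M2 hM2 hM2' using fun n =>
    exists_bound_iteratedFDeriv (hDs n) ((b n).hasCompactSupport.mul_right) n
  have hM1p : ∀ n, 0 < M1 n := fun n => by linarith [hM1 n]
  have hM2p : ∀ n, 0 < M2 n := fun n => by linarith [hM2 n]
  have hv : 0 < 1 + ‖v‖ := by positivity
  -- These choices bound each of the two summands of the n-th term by `τ n`, in all derivatives of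
  -- order at most n. The summand 1 in `1 + ‖v‖` covers v = 0.
  refine ⟨fun n => τ n / M1 n, fun n => τ n / (M2 n * (1 + ‖v‖)), τ,
    fun n => div_pos (hτ n) (hM1p n), fun n => div_pos (hτ n) (mul_pos (hM2p n) hv), ?_, ?_, ?_⟩
  · refine squeeze_zero (fun n => (div_pos (hτ n) (hM1p n)).le)
      (fun n => div_le_self (hτ n).le (hM1 n)) ?_
    exact tendsto_pow_atTop_nhds_zero_of_lt_one (by norm_num) (by norm_num)
  · exact tendsto_pow_atTop_nhds_zero_of_lt_one (by norm_num) (by norm_num)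
  intro z hz
  set ε : ℕ → ℝ := fun n => τ n / (M2 n * (1 + ‖v‖)) with hε
  let f : ℕ → ℝ → V := fun n t => b n t • z n + D n t • (ε n • v)
  have hfs : ∀ n, ContDiff ℝ ∞ (f n) := fun n =>
    ((hbs n).smul contDiff_const).add ((hDs n).smul contDiff_const)
  have hf0 : ∀ n t, τ n / 4 ≤ |t - τ n| → f n t = 0 := fun n t h => by
    simp [f, D, hb0 n t h]
  refine ⟨fun t => ∑' n, f n t, ?_, ?_, ?_⟩
  · refine contDiff_tsum_of_eventually (v := fun _ n => 2 * τ n) hfs ?_ ?_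
    · intro k _
      exact (summable_geometric_of_lt_one (by norm_num) (by norm_num)).mul_left 2
    -- Order k is controlled only in the terms with n ≥ k, which is all but finitely many.
    · intro k _
      rw [Nat.cofinite_eq_atTop]
      filter_upwards [eventually_ge_atTop k] with n hn t
      have e : iteratedFDeriv ℝ k (f n) t = iteratedFDeriv ℝ k (fun t => b n t • z n) t
          + iteratedFDeriv ℝ k (fun t => D n t • (ε n • v)) t := by
        have h1 : ContDiff ℝ k (fun t => b n t • z n) := ((hbs n).smul contDiff_const).of_le
          (by exact_mod_cast le_top)
        have h2 : ContDiff ℝ k (fun t => D n t • (ε n • v)) := ((hDs n).smul contDiff_const).of_le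
          (by exact_mod_cast le_top)
        have := iteratedFDeriv_add (i := k) (𝕜 := ℝ) h1 h2
        exact congrFun this t
      rw [e]
      refine (norm_add_le _ _).trans ?_
      have h1 := norm_iteratedFDeriv_smul_const_le (hbs n) (z n) k t
      have h2 := norm_iteratedFDeriv_smul_const_le (hDs n) (ε n • v) k t
      have h3 : ‖z n‖ * ‖iteratedFDeriv ℝ k (b n) t‖ ≤ τ n / M1 n * M1 n :=
        mul_le_mul (hz n) (hM1' n k hn t) (norm_nonneg _) (div_pos (hτ n) (hM1p n)).le
      have h4 : ‖ε n • v‖ ≤ τ n / M2 n := by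
        rw [norm_smul, Real.norm_of_nonneg (div_pos (hτ n) (mul_pos (hM2p n) hv)).le,
          div_mul_eq_mul_div, div_le_div_iff₀ (mul_pos (hM2p n) hv) (hM2p n)]
        nlinarith [mul_pos (hτ n) (hM2p n), norm_nonneg v]
      have h5 : ‖ε n • v‖ * ‖iteratedFDeriv ℝ k (D n) t‖ ≤ τ n / M2 n * M2 n :=
        mul_le_mul h4 (hM2' n k hn t) (norm_nonneg _) (div_pos (hτ n) (hM2p n)).le
      rw [div_mul_cancel₀ _ (hM1p n).ne'] at h3
      rw [div_mul_cancel₀ _ (hM2p n).ne'] at h5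
      linarith
  · have : ∀ n, f n 0 = 0 := fun n => hf0 n 0 (by
      rw [zero_sub, abs_neg, abs_of_pos (hτ n)]; linarith [hτ n])
    simp [this]
  · intro n
    have hn : Metric.ball (τ n) (τ n / 8) ∈ 𝓝 (τ n) :=
      Metric.ball_mem_nhds _ (by have := hτ n; positivity)
    filter_upwards [hn] with t ht
    rw [Metric.mem_ball, Real.dist_eq] at ht
    have ht' := abs_lt.1 ht
    rw [tsum_eq_single n]
    · have : b n t = 1 := (b n).one_of_mem_closedBall (by
        rw [Metric.mem_closedBall, Real.dist_eq]; exact ht.le)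
      simp only [f, D, this, one_smul, one_mul, smul_smul]
      rw [mul_comm]
    · intro m hm
      apply hf0
      rcases lt_or_gt_of_ne hm with h | h
      · have := hτm n m h
        rw [abs_sub_comm]
        refine le_trans ?_ (le_abs_self _)
        linarith [hτ m]
      · have := hτm m n h
        refine le_trans ?_ (le_abs_self _)
        linarith [hτ m]

/-- A smooth map `V → V` with values in an open set `U` which is the identity near `x ∈ U`. -/
theorem exists_cutoff [HasContDiffBump V] {U : Set V} (hU : IsOpen U) {x : V} (hx : x ∈ U) :
    ∃ h : V → V, ContDiff ℝ ∞ h ∧ (∀ᶠ y in 𝓝 x, h y = y) ∧ ∀ y, h y ∈ U := by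
  obtain ⟨r, hr, hrU⟩ := Metric.isOpen_iff.1 hU x hx
  let b : ContDiffBump x := ⟨r / 2, r, by positivity, by linarith⟩
  refine ⟨fun y => x + b y • (y - x), ?_, ?_, fun y => hrU ?_⟩
  · exact contDiff_const.add (b.contDiff.smul (contDiff_id.sub contDiff_const))
  · filter_upwards [b.eventuallyEq_one] with y hy
    rw [hy]; simp
  · rw [Metric.mem_ball, dist_eq_norm, add_sub_cancel_left, norm_smul,
      Real.norm_of_nonneg b.nonneg]
    by_cases h : r ≤ dist y x
    · rw [b.zero_of_le_dist h]; simpa using hr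
    · rw [← dist_eq_norm]
      nlinarith [b.le_one (x := y), b.nonneg (x := y), dist_nonneg (x := y) (y := x)]

/-- A set is open if its preimages under all smooth curves are. -/
theorem isOpen_of_preimage_curves [CompleteSpace V] {A : Set V}
    (h : ∀ c : ℝ → V, ContDiff ℝ ∞ c → IsOpen (c ⁻¹' A)) : IsOpen A := by
  obtain ⟨δ, ε, τ, hδ, -, hδ0, hτ0, H⟩ := exists_special_curve (0 : V)
  rw [isOpen_iff_mem_nhds]
  intro x hx
  by_contra hA
  -- If A is not a neighbourhood of x, points outside A converge to x as fast as desired, and a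
  -- special curve through them has a preimage of A that is not open at 0.
  have : ∀ n, ∃ z : V, ‖z‖ ≤ δ n ∧ x + z ∉ A := by
    intro n
    by_contra! hn
    refine hA (Filter.mem_of_superset (Metric.closedBall_mem_nhds x (hδ n)) fun y hy => ?_)
    have := hn (y - x) (by rwa [← dist_eq_norm])
    rwa [add_sub_cancel] at this
  choose z hz hzA using this
  obtain ⟨c, hc, hc0, hcz⟩ := H z hz
  have ho := h (fun t => x + c t) (contDiff_const.add hc)
  have h0 : (fun t => x + c t) ⁻¹' A ∈ 𝓝 (0 : ℝ) := ho.mem_nhds (by simpa [hc0] using hx)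
  obtain ⟨n, hn⟩ := (hτ0.eventually h0).exists
  have := (hcz n).self_of_nhds
  simp only [this] at hn
  exact hzA n (by simpa using hn)

end SpecialCurves

/-! ### Boman's theorem for compactly supported functions, by Fourier decay. -/

section Boman

open MeasureTheory FourierTransform

variable {V : Type*} [NormedAddCommGroup V] [InnerProductSpace ℝ V]

/-- A function vanishing near x along the line has zero derivative there, so the support never
grows; no continuity of the derivatives is needed. -/
theorem eq_zero_of_lineDerivs {g : ℕ → V → ℂ} {v : V}
    (hg : ∀ p x, HasLineDerivAt ℝ (g p) (g (p + 1) x) x v) (p : ℕ) :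
    ∀ x ∉ tsupport (g 0), g p x = 0 := by
  induction p with
  | zero => exact fun x hx => image_eq_zero_of_notMem_tsupport hx
  | succ p ih =>
    intro x hx
    have h1 : HasDerivAt (fun t : ℝ => g p (x + t • v)) (g (p + 1) x) 0 := hg p x
    have hc : Continuous fun t : ℝ => x + t • v := by fun_prop
    have h2 : (fun t : ℝ => g p (x + t • v)) =ᶠ[𝓝 0] fun _ => 0 := by
      have : ∀ᶠ t : ℝ in 𝓝 0, x + t • v ∈ (tsupport (g 0))ᶜ :=
        hc.continuousAt.eventually_mem
          ((isClosed_tsupport _).isOpen_compl.mem_nhds (by simpa using hx))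
      filter_upwards [this] with t ht using ih _ ht
    exact h1.unique ((hasDerivAt_const (0 : ℝ) (0 : ℂ)).congr_of_eventuallyEq h2)

/-- The exponential `x ↦ exp (-2πi ⟪x, ξ⟫)`. -/
noncomputable def fourierExp (ξ x : V) : ℂ :=
  Complex.exp ((↑(-2 * Real.pi * inner ℝ x ξ) : ℂ) * Complex.I)

theorem norm_fourierExp (ξ x : V) : ‖fourierExp ξ x‖ = 1 :=
  Complex.norm_exp_ofReal_mul_I _

theorem continuous_fourierExp (ξ : V) : Continuous (fourierExp ξ) := by
  unfold fourierExp; fun_prop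

theorem hasLineDerivAt_fourierExp (ξ x v : V) : HasLineDerivAt ℝ (fourierExp ξ)
    (-(2 * Real.pi * inner ℝ v ξ * Complex.I) * fourierExp ξ x) x v := by
  have h1 : HasDerivAt (fun t : ℝ => -2 * Real.pi * inner ℝ (x + t • v) ξ)
      (-2 * Real.pi * inner ℝ v ξ) 0 := by
    have : (fun t : ℝ => -2 * Real.pi * inner ℝ (x + t • v) ξ) =
        fun t : ℝ => -2 * Real.pi * inner ℝ x ξ + t * (-2 * Real.pi * inner ℝ v ξ) := by
      funext t; rw [inner_add_left, real_inner_smul_left]; ring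
    rw [this]
    simpa using ((hasDerivAt_id (0 : ℝ)).mul_const (-2 * Real.pi * inner ℝ v ξ)).const_add
      (-2 * Real.pi * inner ℝ x ξ)
  have h2 := ((h1.ofReal_comp.mul_const Complex.I).cexp)
  refine h2.congr_deriv ?_
  simp only [zero_smul, add_zero, fourierExp]
  push_cast
  ring

theorem continuous_of_smooth_along_curves [FiniteDimensional ℝ V] {f : V → ℝ}
    (hf : ∀ c : ℝ → V, ContDiff ℝ ∞ c → ContDiff ℝ ∞ fun t => f (c t)) : Continuous f :=
  haveI := FiniteDimensional.complete ℝ V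
  continuous_def.2 fun _ hU => isOpen_of_preimage_curves fun c hc =>
    hU.preimage (hf c hc).continuous

/-- Functions which are smooth along smooth curves are smooth along lines, with locally bounded
derivatives of all orders. -/
theorem exists_bound_iteratedDeriv_line [FiniteDimensional ℝ V] {f : V → ℝ}
    (hf : ∀ c : ℝ → V, ContDiff ℝ ∞ c → ContDiff ℝ ∞ fun t => f (c t)) (v : V) (p : ℕ) (x : V) :
    ∃ C, ∀ᶠ y in 𝓝 x, |iteratedDeriv p (fun t : ℝ => f (y + t • v)) 0| ≤ C := by
  have hcV := FiniteDimensional.complete ℝ V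
  have hl : ∀ y : V, ContDiff ℝ ∞ fun t : ℝ => f (y + t • v) := fun y =>
    hf _ (contDiff_const.add (contDiff_id.smul contDiff_const))
  by_contra! hC
  obtain ⟨δ, ε, τ, hδ, hε, hδ0, hτ0, H⟩ := exists_special_curve v
  -- The special curve has velocity `ε n • v` at `τ n`, so the chain rule multiplies the p-th
  -- derivative by `ε n ^ p`. Dividing by it here leaves derivatives exceeding n at times tending to
  -- 0, against continuity.
  have : ∀ n : ℕ, ∃ z : V, ‖z‖ ≤ δ n ∧
      (n : ℝ) / ε n ^ p < |iteratedDeriv p (fun t : ℝ => f ((x + z) + t • v)) 0| := by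
    intro n
    obtain ⟨y, h1, h2⟩ := ((hC (n / ε n ^ p)).and_eventually
      (Metric.closedBall_mem_nhds x (hδ n))).exists
    refine ⟨y - x, by rwa [← dist_eq_norm], ?_⟩
    rwa [add_sub_cancel]
  choose z hz hzf using this
  obtain ⟨c, hc, hc0, hcz⟩ := H z hz
  have hs := hf (fun t => x + c t) (contDiff_const.add hc)
  have hcont : Continuous (iteratedDeriv p fun t => f (x + c t)) :=
    hs.continuous_iteratedDeriv p (by exact_mod_cast le_top)
  have hval : ∀ n, iteratedDeriv p (fun t => f (x + c t)) (τ n) =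
      ε n ^ p * iteratedDeriv p (fun t : ℝ => f ((x + z n) + t • v)) 0 := by
    intro n
    have e : (fun t => f (x + c t)) =ᶠ[𝓝 (τ n)]
        fun t => (fun s => f ((x + z n) + (ε n * s) • v)) (t - τ n) := by
      filter_upwards [hcz n] with t ht
      rw [ht, add_assoc]
    have h2 := congrFun (iteratedDeriv_comp_sub_const p
      (fun s => f ((x + z n) + (ε n * s) • v)) (τ n)) (τ n)
    rw [e.iteratedDeriv_eq, h2, sub_self,
      iteratedDeriv_comp_const_mul (f := fun s => f ((x + z n) + s • v))
        ((hl _).of_le (by exact_mod_cast le_top)) (ε n)]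
    simp
  have hlim := ((hcont.tendsto 0).comp hτ0).abs
  obtain ⟨N, hN⟩ := exists_nat_gt (|iteratedDeriv p (fun t => f (x + c t)) 0|)
  have h1 := hlim.eventually (gt_mem_nhds hN)
  obtain ⟨n, hn1, hn2⟩ := (h1.and (eventually_ge_atTop N)).exists
  have h3 := hzf n
  rw [div_lt_iff₀ (pow_pos (hε n) p)] at h3
  simp only [Function.comp, hval, abs_mul, abs_pow, abs_of_pos (hε n)] at hn1
  have : (N : ℝ) ≤ n := by exact_mod_cast hn2
  linarith [mul_comm (ε n ^ p) |iteratedDeriv p (fun t : ℝ => f ((x + z n) + t • v)) 0|]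

/-- The higher derivatives are not known to be continuous, but they are pointwise limits of
difference quotients with step 1/(n+1). -/
theorem measurable_of_lineDerivs [MeasurableSpace V] [BorelSpace V] {g : ℕ → V → ℂ} {v : V}
    (hg : ∀ p x, HasLineDerivAt ℝ (g p) (g (p + 1) x) x v) (h0 : Continuous (g 0)) (p : ℕ) :
    Measurable (g p) := by
  induction p with
  | zero => exact h0.measurable
  | succ p ih =>
    refine measurable_of_tendsto_metrizable
      (f := fun (n : ℕ) (x : V) => ((1 : ℝ) / ((n : ℝ) + 1))⁻¹ •
        (g p (x + ((1 : ℝ) / ((n : ℝ) + 1)) • v) - g p x)) (fun n => ?_) ?_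
    · exact ((ih.comp (measurable_id.add_const _)).sub ih).const_smul (((1 : ℝ) / ((n : ℝ) + 1))⁻¹)
    · rw [tendsto_pi_nhds]
      intro x
      refine (hg p x).tendsto_slope_zero.comp (tendsto_nhdsWithin_iff.2
        ⟨tendsto_one_div_add_atTop_nhds_zero_nat, Eventually.of_forall fun n => ?_⟩)
      have : (0 : ℝ) < 1 / ((n : ℝ) + 1) := by positivity
      exact this.ne'

variable [FiniteDimensional ℝ V] [MeasurableSpace V] [BorelSpace V]

theorem integrable_of_lineDerivs {g : ℕ → V → ℂ} {v : V}
    (hg : ∀ p x, HasLineDerivAt ℝ (g p) (g (p + 1) x) x v) (h0 : Continuous (g 0))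
    (hs : HasCompactSupport (g 0)) (hb : ∀ p, ∃ C, ∀ x, ‖g p x‖ ≤ C) (p : ℕ) :
    Integrable (g p) := by
  obtain ⟨C, hC⟩ := hb p
  have hK : IsCompact (tsupport (g 0)) := hs
  have h1 : IntegrableOn (g p) (tsupport (g 0)) :=
    Measure.integrableOn_of_bounded hK.measure_lt_top.ne
      (measurable_of_lineDerivs hg h0 p).aestronglyMeasurable (M := C)
      (Eventually.of_forall hC)
  refine (integrableOn_iff_integrable_of_support_subset fun x hx => ?_).1 h1
  by_contra h
  exact hx (eq_zero_of_lineDerivs hg p x h)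

/-- Iterated integration by parts: each derivative along v moves onto the exponential and produces a
factor 2πi⟨v, ξ⟩. -/
theorem integral_lineDerivs_mul_fourierExp {g : ℕ → V → ℂ} {v : V}
    (hg : ∀ p x, HasLineDerivAt ℝ (g p) (g (p + 1) x) x v) (h0 : Continuous (g 0))
    (hs : HasCompactSupport (g 0)) (hb : ∀ p, ∃ C, ∀ x, ‖g p x‖ ≤ C) (ξ : V) (p : ℕ) :
    ∫ x, g p x * fourierExp ξ x = (2 * Real.pi * inner ℝ v ξ * Complex.I) ^ p *
      ∫ x, g 0 x * fourierExp ξ x := by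
  have hi : ∀ p, Integrable (fun x => g p x * fourierExp ξ x) := fun p =>
    (integrable_of_lineDerivs hg h0 hs hb p).mul_bdd (c := 1)
      (continuous_fourierExp ξ).aestronglyMeasurable
      (Eventually.of_forall fun x => (norm_fourierExp ξ x).le)
  induction p with
  | zero => simp
  | succ p ih =>
    have := integral_bilinear_hasLineDerivAt_right_eq_neg_left_of_integrable (μ := volume)
      (B := ContinuousLinearMap.mul ℝ ℂ) (f := g p) (f' := g (p + 1)) (v := v)
      (g := fourierExp ξ)
      (g' := fun x => -(2 * Real.pi * inner ℝ v ξ * Complex.I) * fourierExp ξ x)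
      (hi (p + 1)) (by
        have := (hi p).const_mul (-(2 * Real.pi * inner ℝ v ξ * Complex.I))
        refine this.congr (Eventually.of_forall fun x => ?_)
        simp only [ContinuousLinearMap.mul_apply']
        ring) (hi p) (fun x _ => hg p x)
      (fun x _ => hasLineDerivAt_fourierExp ξ x v)
    simp only [ContinuousLinearMap.mul_apply'] at this
    have e : ∀ x, g p x * (-(2 * Real.pi * inner ℝ v ξ * Complex.I) * fourierExp ξ x) =
        -(2 * Real.pi * inner ℝ v ξ * Complex.I) * (g p x * fourierExp ξ x) := fun x => by ring
    simp_rw [e] at this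
    rw [integral_const_mul, ih] at this
    rw [pow_succ]
    linear_combination this

theorem fourier_eq_integral_fourierExp (F : V → ℂ) (ξ : V) :
    𝓕 F ξ = ∫ x, F x * fourierExp ξ x := by
  rw [Real.fourier_eq']
  refine integral_congr_ae (Eventually.of_forall fun x => ?_)
  simp only [fourierExp, smul_eq_mul]
  ring

theorem exists_bound_fourier_directional {g : ℕ → V → ℂ} {v : V}
    (hg : ∀ p x, HasLineDerivAt ℝ (g p) (g (p + 1) x) x v) (h0 : Continuous (g 0))
    (hs : HasCompactSupport (g 0)) (hb : ∀ p, ∃ C, ∀ x, ‖g p x‖ ≤ C) (p : ℕ) :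
    ∃ C, ∀ ξ, |inner ℝ v ξ| ^ p * ‖𝓕 (g 0) ξ‖ ≤ C := by
  refine ⟨∫ x, ‖g p x‖, fun ξ => ?_⟩
  have h1 : ‖∫ x, g p x * fourierExp ξ x‖ ≤ ∫ x, ‖g p x‖ := by
    refine (norm_integral_le_integral_norm _).trans_eq ?_
    simp [norm_fourierExp]
  rw [integral_lineDerivs_mul_fourierExp hg h0 hs hb, ← fourier_eq_integral_fourierExp,
    norm_mul, norm_pow] at h1
  refine le_trans ?_ h1
  gcongr
  have : ‖(2 * Real.pi * inner ℝ v ξ * Complex.I : ℂ)‖ = 2 * Real.pi * |inner ℝ v ξ| := by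
    simp [abs_of_pos Real.pi_pos]
  rw [this]
  have : 1 ≤ 2 * Real.pi := by linarith [Real.pi_gt_three]
  nlinarith [abs_nonneg (inner ℝ v ξ)]

/-- Directional decay suffices: ‖ξ‖ is at most the sum of its coordinates' absolute values in an
orthonormal basis, and the power mean inequality passes to powers. -/
theorem exists_bound_fourier {F : V → ℂ} (h0 : Continuous F) (hs : HasCompactSupport F)
    (h : ∀ v : V, ∃ g : ℕ → V → ℂ, g 0 = F ∧
      (∀ p x, HasLineDerivAt ℝ (g p) (g (p + 1) x) x v) ∧ ∀ p, ∃ C, ∀ x, ‖g p x‖ ≤ C) (p : ℕ) :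
    ∃ C, ∀ ξ, ‖ξ‖ ^ p * ‖𝓕 F ξ‖ ≤ C := by
  have hd : ∀ (v : V) (p : ℕ), ∃ C, ∀ ξ, |inner ℝ v ξ| ^ p * ‖𝓕 F ξ‖ ≤ C := by
    intro v p
    obtain ⟨g, rfl, h1, h2⟩ := h v
    exact exists_bound_fourier_directional h1 h0 hs h2 p
  let b := stdOrthonormalBasis ℝ V
  rcases p with _ | p
  · obtain ⟨C, hC⟩ := hd 0 0
    exact ⟨C, by simpa using hC⟩
  choose C hC using fun i => hd (b i) (p + 1)
  let d : ℝ := ((Finset.univ : Finset (Fin (Module.finrank ℝ V))).card : ℝ) ^ p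
  refine ⟨d * ∑ i, C i, fun ξ => ?_⟩
  have h1 : ‖ξ‖ ≤ ∑ i, |inner ℝ (b i) ξ| := by
    conv_lhs => rw [← b.sum_repr' ξ]
    refine (norm_sum_le _ _).trans (Finset.sum_le_sum fun i _ => ?_)
    rw [norm_smul, b.norm_eq_one, mul_one, Real.norm_eq_abs]
  have h2 : ‖ξ‖ ^ (p + 1) ≤ d * ∑ i, |inner ℝ (b i) ξ| ^ (p + 1) := by
    refine (pow_le_pow_left₀ (norm_nonneg _) h1 _).trans ?_
    have h3 := pow_sum_div_card_le_sum_pow (s := Finset.univ)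
      (f := fun i => |inner ℝ (b i) ξ|) (fun i _ => abs_nonneg _) p
    rcases (Finset.univ : Finset (Fin (Module.finrank ℝ V))).eq_empty_or_nonempty with h4 | h4
    · simp [h4]
    · have hd : 0 < d := pow_pos (by exact_mod_cast Finset.card_pos.2 h4) _
      rwa [div_le_iff₀' hd] at h3
  calc ‖ξ‖ ^ (p + 1) * ‖𝓕 F ξ‖ ≤ (d * ∑ i, |inner ℝ (b i) ξ| ^ (p + 1)) * ‖𝓕 F ξ‖ := by gcongr
    _ = d * ∑ i, |inner ℝ (b i) ξ| ^ (p + 1) * ‖𝓕 F ξ‖ := by rw [mul_assoc, Finset.sum_mul]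
    _ ≤ d * ∑ i, C i := by
      refine mul_le_mul_of_nonneg_left (Finset.sum_le_sum fun i _ => hC i ξ) (by positivity)

/-- A continuous compactly supported function all of whose iterated directional derivatives
exist and are bounded is smooth. -/
theorem contDiff_of_lineDerivs {F : V → ℂ} (h0 : Continuous F) (hs : HasCompactSupport F)
    (h : ∀ v : V, ∃ g : ℕ → V → ℂ, g 0 = F ∧
      (∀ p x, HasLineDerivAt ℝ (g p) (g (p + 1) x) x v) ∧ ∀ p, ∃ C, ∀ x, ‖g p x‖ ≤ C) :
    ContDiff ℝ ∞ F := by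
  have hF : Integrable F := h0.integrable_of_hasCompactSupport hs
  have hFc : Continuous (𝓕 F) :=
    VectorFourier.fourierIntegral_continuous Real.continuous_fourierChar
      (by exact continuous_inner) hF
  -- The bound of order 0 handles bounded ξ; the surplus `integrablePower` in the second bound gives
  -- integrability at infinity.
  have hi : ∀ n : ℕ, Integrable (fun ξ => ‖ξ‖ ^ n * ‖𝓕 F ξ‖) := fun n => by
    obtain ⟨C₁, h₁⟩ := exists_bound_fourier h0 hs h 0
    obtain ⟨C₂, h₂⟩ := exists_bound_fourier h0 hs h
      (n + (volume : Measure V).integrablePower)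
    exact integrable_of_le_of_pow_mul_le (fun x => by simpa using h₁ x) h₂
      hFc.aestronglyMeasurable
  have hi0 : Integrable (𝓕 F) := by
    have := hi 0
    simp only [pow_zero, one_mul] at this
    exact (integrable_norm_iff hFc.aestronglyMeasurable).1 this
  have h1 : ContDiff ℝ ∞ (𝓕 (𝓕 F)) := Real.contDiff_fourier fun n _ => hi n
  have h2 : F = fun v => 𝓕 (𝓕 F) (-v) := by
    funext v
    rw [← Real.fourierInv_eq_fourier_neg, h0.fourierInv_fourier_eq hF hi0]
  rw [h2]
  exact h1.comp contDiff_neg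

theorem contDiff_of_smooth_along_curves_of_hasCompactSupport {f : V → ℝ}
    (hf : ∀ c : ℝ → V, ContDiff ℝ ∞ c → ContDiff ℝ ∞ fun t => f (c t))
    (hs : HasCompactSupport f) : ContDiff ℝ ∞ f := by
  have hl : ∀ v y : V, ContDiff ℝ ∞ fun t : ℝ => f (y + t • v) := fun v y =>
    hf _ (contDiff_const.add (contDiff_id.smul contDiff_const))
  have hcont := continuous_of_smooth_along_curves hf
  have hsc : HasCompactSupport (fun x => (f x : ℂ)) := hs.comp_left (g := ((↑) : ℝ → ℂ)) rfl
  suffices h : ContDiff ℝ ∞ (fun x => (f x : ℂ)) from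
    Complex.reCLM.contDiff.comp h
  refine contDiff_of_lineDerivs (Complex.continuous_ofReal.comp hcont) hsc fun v => ?_
  let g : ℕ → V → ℂ := fun p x => ((iteratedDeriv p (fun t : ℝ => f (x + t • v)) 0 : ℝ) : ℂ)
  have hg0 : g 0 = fun x => (f x : ℂ) := by funext x; simp [g]
  have hgd : ∀ p x, HasLineDerivAt ℝ (g p) (g (p + 1) x) x v := by
    intro p x
    -- Moving the base point along v is a shift of the line parameter, so differentiating in the
    -- base point raises the order by one.
    have e : ∀ s : ℝ, iteratedDeriv p (fun t : ℝ => f ((x + s • v) + t • v)) 0 =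
        iteratedDeriv p (fun t : ℝ => f (x + t • v)) s := by
      intro s
      have := congrFun (iteratedDeriv_comp_const_add p (fun t : ℝ => f (x + t • v)) s) 0
      simp only [add_zero] at this
      rw [← this]
      congr 1
      funext t
      rw [add_smul, add_assoc]
    have hd : HasDerivAt (iteratedDeriv p (fun t : ℝ => f (x + t • v)))
        (iteratedDeriv (p + 1) (fun t : ℝ => f (x + t • v)) 0) 0 := by
      rw [iteratedDeriv_succ]
      exact (((hl v x).differentiable_iteratedDeriv p
        (by exact_mod_cast WithTop.coe_lt_top _)) 0).hasDerivAt
    have := hd.ofReal_comp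
    simp only [HasLineDerivAt, g, e]
    exact this
  refine ⟨g, hg0, hgd, fun p => ?_⟩
  have hK : IsCompact (tsupport fun x => (f x : ℂ)) := hsc
  choose C hC using exists_bound_iteratedDeriv_line hf v p
  obtain ⟨T, -, hT⟩ := hK.elim_nhds_subcover
    (fun x => {y | |iteratedDeriv p (fun t : ℝ => f (y + t • v)) 0| ≤ C x}) (fun x _ => hC x)
  refine ⟨∑ x ∈ T, |C x|, fun y => ?_⟩
  by_cases hy : y ∈ tsupport fun x => (f x : ℂ)
  · obtain ⟨x, hxT, hx⟩ := mem_iUnion₂.1 (hT hy)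
    have h1 : ‖g p y‖ = |iteratedDeriv p (fun t : ℝ => f (y + t • v)) 0| := by
      simp only [g, Complex.norm_real, Real.norm_eq_abs]
    rw [h1]
    exact (hx.trans (le_abs_self _)).trans
      (Finset.single_le_sum (f := fun x => |C x|) (fun _ _ => abs_nonneg _) hxT)
  · rw [eq_zero_of_lineDerivs hgd p y (by rwa [hg0]), norm_zero]
    exact Finset.sum_nonneg fun _ _ => abs_nonneg _

end Boman

/-! ### Boman's theorem on open sets of finite-dimensional spaces. -/

section BomanLocal

variable {V : Type*} [NormedAddCommGroup V] [NormedSpace ℝ V] [FiniteDimensional ℝ V]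

/-- Boman's theorem: a function on an open set `W` which is smooth along all smooth curves in `W`
is smooth. -/
theorem contDiffOn_of_smooth_along_curves {f : V → ℝ} {W : Set V} (hW : IsOpen W)
    (hf : ∀ c : ℝ → V, ContDiff ℝ ∞ c → (∀ t, c t ∈ W) → ContDiff ℝ ∞ fun t => f (c t)) :
    ContDiffOn ℝ ∞ f W := by
  intro x hx
  refine ContDiffAt.contDiffWithinAt ?_
  obtain ⟨r, hr, hrW⟩ := Metric.isOpen_iff.1 hW x hx
  let b : ContDiffBump x := ⟨r / 4, r / 2, by positivity, by linarith⟩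
  have hbW : tsupport b ⊆ W := by
    rw [b.tsupport_eq]
    exact (Metric.closedBall_subset_ball (by change r / 2 < r; linarith)).trans hrW
  let F : V → ℝ := fun y => b y * f y
  have hFs : HasCompactSupport F := b.hasCompactSupport.mul_right
  have hFc : ∀ c : ℝ → V, ContDiff ℝ ∞ c → ContDiff ℝ ∞ fun t => F (c t) := by
    intro c hc
    rw [contDiff_iff_contDiffAt]
    intro t
    by_cases ht : c t ∈ W
    · obtain ⟨h, hh, hh1, hh2⟩ := exists_cutoff (hW.preimage hc.continuous) (x := t) ht
      have h1 : ContDiff ℝ ∞ fun s => b (c s) * f (c (h s)) :=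
        (b.contDiff.comp hc).mul (hf (fun s => c (h s)) (hc.comp hh) hh2)
      refine h1.contDiffAt.congr_of_eventuallyEq ?_
      filter_upwards [hh1] with s hs
      simp only [F, hs]
    · have h1 : ∀ᶠ s in 𝓝 t, c s ∈ (tsupport b)ᶜ :=
        hc.continuous.continuousAt.eventually_mem
          ((isClosed_tsupport _).isOpen_compl.mem_nhds fun h => ht (hbW h))
      refine (contDiffAt_const (c := (0 : ℝ))).congr_of_eventuallyEq ?_
      filter_upwards [h1] with s hs
      simp only [F, image_eq_zero_of_notMem_tsupport hs, zero_mul]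
  have hF : ContDiff ℝ ∞ F := by
    -- The Fourier argument needs an inner product, so F is transported to Euclidean space.
    let e : V ≃L[ℝ] EuclideanSpace ℝ (Fin (Module.finrank ℝ V)) :=
      ContinuousLinearEquiv.ofFinrankEq (by simp)
    have h1 : ContDiff ℝ ∞ fun y => F (e.symm y) := by
      refine contDiff_of_smooth_along_curves_of_hasCompactSupport (fun c hc => ?_) ?_
      · exact hFc (fun t => e.symm (c t)) (e.symm.contDiff.comp hc)
      · exact hFs.comp_homeomorph e.symm.toHomeomorph
    have h2 := h1.comp e.contDiff
    have h3 : (fun y => F (e.symm y)) ∘ e = F := by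
      funext y
      simp
    rwa [h3] at h2
  refine hF.contDiffAt.congr_of_eventuallyEq ?_
  filter_upwards [b.eventuallyEq_one] with y hy
  simp only [F, hy]
  simp

end BomanLocal

/-! ### Smooth parameter integrals and Hadamard's lemma. -/

section ParametricIntegral

open MeasureTheory

theorem hasDerivAt_integral_of_contDiff {b : ℝ × ℝ → ℝ} (hb : ContDiff ℝ ∞ b) (s₀ : ℝ) :
    HasDerivAt (fun s => ∫ t in (0 : ℝ)..1, b (t, s)) (∫ t in (0 : ℝ)..1, fderiv ℝ b (t, s₀) (0, 1))
      s₀ := by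
  have hd : Continuous fun p => fderiv ℝ b p (0, 1) :=
    (hb.continuous_fderiv (by simp)).clm_apply continuous_const
  have hK : IsCompact (Icc (0 : ℝ) 1 ×ˢ Icc (s₀ - 1) (s₀ + 1)) := isCompact_Icc.prod isCompact_Icc
  obtain ⟨C, hC⟩ := hK.exists_bound_of_continuousOn hd.continuousOn
  have hcs : ∀ s, Continuous fun t => b (t, s) := fun s => hb.continuous.comp (by fun_prop)
  refine (intervalIntegral.hasDerivAt_integral_of_dominated_loc_of_deriv_le (bound := fun _ => C)
    (F := fun s t => b (t, s)) (F' := fun s t => fderiv ℝ b (t, s) (0, 1))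
    (Icc_mem_nhds (show s₀ - 1 < s₀ by linarith) (show s₀ < s₀ + 1 by linarith))
    (Eventually.of_forall fun s => (hcs s).aestronglyMeasurable) ((hcs s₀).intervalIntegrable _ _)
    (hd.comp (by fun_prop : Continuous fun t : ℝ => (t, s₀))).aestronglyMeasurable ?_ (by simp)
    ?_).2
  · refine Eventually.of_forall fun t ht s hs => hC (t, s) ⟨?_, hs⟩
    rw [uIoc_of_le zero_le_one] at ht
    exact ⟨ht.1.le, ht.2⟩
  · refine Eventually.of_forall fun t _ s _ => ?_
    have h1 : HasFDerivAt b (fderiv ℝ b (t, s)) (t, s) :=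
      (hb.differentiable (by simp) _).hasFDerivAt
    exact h1.comp_hasDerivAt s ((hasDerivAt_const s t).prodMk (hasDerivAt_id s))

/-- The derivative is an integral of the same kind with integrand ∂b/∂s, so induction on the order,
with b arbitrary, applies. -/
theorem contDiff_integral_of_contDiff {b : ℝ × ℝ → ℝ} (hb : ContDiff ℝ ∞ b) :
    ContDiff ℝ ∞ fun s => ∫ t in (0 : ℝ)..1, b (t, s) := by
  rw [contDiff_infty]
  intro n
  induction n generalizing b with
  | zero =>
    exact contDiff_zero.2 (Differentiable.continuous fun s =>
      (hasDerivAt_integral_of_contDiff hb s).differentiableAt)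
  | succ n ih =>
    have hd : ContDiff ℝ ∞ fun p => fderiv ℝ b p (0, 1) :=
      (hb.fderiv_right (m := ∞) (by simp)).clm_apply contDiff_const
    have := ih hd
    push_cast
    rw [contDiff_succ_iff_deriv]
    refine ⟨fun s => (hasDerivAt_integral_of_contDiff hb s).differentiableAt, by simp, ?_⟩
    rwa [show deriv (fun s => ∫ t in (0 : ℝ)..1, b (t, s)) = _ from
      funext fun s => (hasDerivAt_integral_of_contDiff hb s).deriv]

/-- Hadamard's lemma. -/
theorem contDiff_hadamard {g : ℝ → ℝ} (hg : ContDiff ℝ ∞ g) (a : ℝ) :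
    ContDiff ℝ ∞ fun t => ∫ σ in (0 : ℝ)..1, deriv g (a + σ * (t - a)) := by
  have hg' : ContDiff ℝ ∞ (deriv g) := (contDiff_infty_iff_deriv.1 hg).2
  exact contDiff_integral_of_contDiff (b := fun p => deriv g (a + p.1 * (p.2 - a)))
    (hg'.comp (by fun_prop))

theorem hadamard_mul {g : ℝ → ℝ} (hg : ContDiff ℝ ∞ g) (a t : ℝ) :
    (t - a) * ∫ σ in (0 : ℝ)..1, deriv g (a + σ * (t - a)) = g t - g a := by
  have hg' : Continuous (deriv g) := (contDiff_infty_iff_deriv.1 hg).2.continuous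
  rw [← intervalIntegral.integral_const_mul]
  have h : ∀ σ ∈ uIcc (0 : ℝ) 1, HasDerivAt (fun σ => g (a + σ * (t - a)))
      ((t - a) * deriv g (a + σ * (t - a))) σ := by
    intro σ _
    have h1 : HasDerivAt g (deriv g (a + σ * (t - a))) (a + σ * (t - a)) :=
      (hg.differentiable (by simp) _).hasDerivAt
    have h2 : HasDerivAt (fun σ : ℝ => a + σ * (t - a)) (t - a) σ := by
      simpa using ((hasDerivAt_id σ).mul_const (t - a)).const_add a
    exact (h1.comp σ h2).congr_deriv (mul_comm _ _)
  rw [intervalIntegral.integral_eq_sub_of_hasDerivAt h]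
  · simp
  · exact (Continuous.mul continuous_const (hg'.comp (by fun_prop))).intervalIntegrable _ _

end ParametricIntegral

/-! ### Calculus of smooth curves in convenient spaces, tested by functionals. -/

section CurveCalculus

variable {E : Type*} [AddCommGroup E] [Module ℝ E] [TopologicalSpace E]

theorem HasVelocityAt.congr_of_eventuallyEq {c d : ℝ → E} {v : E} {t : ℝ}
    (h : HasVelocityAt c v t) (hcd : d =ᶠ[𝓝 t] c) : HasVelocityAt d v t := by
  refine Tendsto.congr' ?_ h
  filter_upwards [hcd.filter_mono nhdsWithin_le_nhds] with s hs
  simp only [slope, hs, hcd.self_of_nhds]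

theorem velocity_congr {c d : ℝ → E} {t : ℝ} (hcd : c =ᶠ[𝓝 t] d) :
    velocity c t = velocity d t := by
  have : slope c t =ᶠ[𝓝[≠] t] slope d t := by
    filter_upwards [hcd.filter_mono nhdsWithin_le_nhds] with s hs
    simp only [slope, hs, hcd.self_of_nhds]
  simp only [velocity, limUnder, Filter.map_congr this]

theorem HasVelocityAt.velocity_eq [T2Space E] {c : ℝ → E} {v : E} {t : ℝ}
    (h : HasVelocityAt c v t) : velocity c t = v := h.limUnder_eq

theorem HasVelocityAt.hasDerivAt {c : ℝ → E} {v : E} {t : ℝ}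
    (h : HasVelocityAt c v t) (l : E →L[ℝ] ℝ) : HasDerivAt (fun s => l (c s)) (l v) t := by
  rw [hasDerivAt_iff_tendsto_slope]
  refine Tendsto.congr (fun s => ?_) ((l.continuous.tendsto v).comp h)
  simp [slope, Function.comp]

theorem HasVelocityAt.hasVelocityAt_shift {c : ℝ → E} {v : E} {t : ℝ} (h : HasVelocityAt c v t) :
    HasVelocityAt (fun s => c (t + s)) v 0 := by
  have h1 : Tendsto (fun s => t + s) (𝓝[≠] (0 : ℝ)) (𝓝[≠] t) := by
    refine tendsto_nhdsWithin_iff.2 ⟨?_, ?_⟩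
    · have : Tendsto (fun s => t + s) (𝓝 (0 : ℝ)) (𝓝 (t + 0)) :=
        Continuous.tendsto (by fun_prop) 0
      rw [add_zero] at this
      exact this.mono_left nhdsWithin_le_nhds
    · filter_upwards [self_mem_nhdsWithin] with s hs
      simpa using hs
  refine Tendsto.congr (fun s => ?_) (Tendsto.comp h h1)
  simp [slope, Function.comp]

theorem SmoothCurveOn.contDiffOn {c : ℝ → E} {J : Set ℝ} (hJ : IsOpen J) (h : SmoothCurveOn c J)
    (l : E →L[ℝ] ℝ) : ContDiffOn ℝ ∞ (fun t => l (c t)) J := by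
  obtain ⟨d, rfl, hd⟩ := h
  -- All iterated derivatives `d k` are treated at once, since the induction on n passes from k to k
  -- + 1.
  suffices H : ∀ n k : ℕ, ContDiffOn ℝ n (fun t => l (d k t)) J from
    contDiffOn_infty.2 fun n => H n 0
  intro n
  induction n with
  | zero =>
    intro k
    exact contDiffOn_zero.2 fun t ht => ((hd k t ht).hasDerivAt l).continuousAt.continuousWithinAt
  | succ n ih =>
    intro k
    push_cast
    rw [contDiffOn_succ_iff_deriv_of_isOpen hJ]
    refine ⟨fun t ht => ((hd k t ht).hasDerivAt l).differentiableAt.differentiableWithinAt,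
      by simp, (ih (k + 1)).congr fun t ht => ((hd k t ht).hasDerivAt l).deriv⟩

theorem SmoothCurve.contDiff {c : ℝ → E} (h : SmoothCurve c) (l : E →L[ℝ] ℝ) :
    ContDiff ℝ ∞ (fun t => l (c t)) :=
  contDiffOn_univ.1 (SmoothCurveOn.contDiffOn isOpen_univ h l)

theorem SmoothCurve.smoothCurveOn {c : ℝ → E} (h : SmoothCurve c) (J : Set ℝ) :
    SmoothCurveOn c J := by
  obtain ⟨d, h0, hd⟩ := h
  exact ⟨d, h0, fun n t _ => hd n t (mem_univ t)⟩

theorem SmoothCurveOn.congr {c c' : ℝ → E} {J : Set ℝ} (hJ : IsOpen J) (h : SmoothCurveOn c J)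
    (hc : ∀ t ∈ J, c' t = c t) : SmoothCurveOn c' J := by
  obtain ⟨d, rfl, hd⟩ := h
  refine ⟨fun n => if n = 0 then c' else d n, by simp, fun n t ht => ?_⟩
  rcases n with _ | n
  · refine (hd 0 t ht).congr_of_eventuallyEq ?_
    filter_upwards [hJ.mem_nhds ht] with s hs using by simpa using hc s hs
  · simpa using hd (n + 1) t ht

theorem SmoothCurve.exists_hasVelocityAt {c : ℝ → E} (h : SmoothCurve c) (t : ℝ) :
    ∃ v, HasVelocityAt c v t := by
  obtain ⟨d, rfl, hd⟩ := h
  exact ⟨_, hd 0 t (mem_univ t)⟩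

variable [ConvenientSpace E]

/-- Hahn–Banach in a Hausdorff locally convex space; it reduces vector identities to scalar ones. -/
theorem eq_of_functionals {x y : E} (h : ∀ l : E →L[ℝ] ℝ, l x = l y) : x = y := by
  by_contra hne
  obtain ⟨l, hl⟩ := SeparatingDual.exists_separating_of_ne (R := ℝ) hne
  exact hl (h l)

theorem smoothCurve_iff {c : ℝ → E} :
    SmoothCurve c ↔ ∀ l : E →L[ℝ] ℝ, ContDiff ℝ ∞ fun t => l (c t) :=
  ⟨fun h => h.contDiff, ConvenientSpace.smooth_of_scalarwise c⟩

theorem SmoothCurve.hasVelocityAt {c : ℝ → E} (h : SmoothCurve c) (t : ℝ) :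
    HasVelocityAt c (velocity c t) t := by
  obtain ⟨v, hv⟩ := h.exists_hasVelocityAt t
  rwa [hv.velocity_eq]

theorem SmoothCurve.deriv_apply {c : ℝ → E} (h : SmoothCurve c) (l : E →L[ℝ] ℝ) (t : ℝ) :
    deriv (fun s => l (c s)) t = l (velocity c t) :=
  ((h.hasVelocityAt t).hasDerivAt l).deriv

/-- The velocity of a smooth curve is determined by the derivatives of its images under
functionals. -/
theorem SmoothCurve.velocity_eq_of_hasDerivAt {c : ℝ → E} (h : SmoothCurve c) {t : ℝ} {v : E}
    (hl : ∀ l : E →L[ℝ] ℝ, HasDerivAt (fun s => l (c s)) (l v) t) : ConvLie.velocity c t = v :=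
  eq_of_functionals fun l => ((h.hasVelocityAt t).hasDerivAt l).unique (hl l)

theorem SmoothCurve.of_local {c : ℝ → E}
    (h : ∀ t, ∃ d : ℝ → E, SmoothCurve d ∧ c =ᶠ[𝓝 t] d) : SmoothCurve c :=
  smoothCurve_iff.2 fun l => contDiff_iff_contDiffAt.2 fun t => by
    obtain ⟨d, hd, hcd⟩ := h t
    exact (hd.contDiff l).contDiffAt.congr_of_eventuallyEq (hcd.fun_comp l)

theorem SmoothCurveOn.comp {c : ℝ → E} {J : Set ℝ} (hJ : IsOpen J) (hc : SmoothCurveOn c J)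
    {h : ℝ → ℝ} (hh : ContDiff ℝ ∞ h) (hhJ : ∀ t, h t ∈ J) : SmoothCurve fun t => c (h t) :=
  smoothCurve_iff.2 fun l => (hc.contDiffOn hJ l).comp_contDiff hh hhJ

theorem SmoothCurve.comp {c : ℝ → E} (hc : SmoothCurve c) {h : ℝ → ℝ} (hh : ContDiff ℝ ∞ h) :
    SmoothCurve fun t => c (h t) :=
  SmoothCurveOn.comp isOpen_univ hc hh fun _ => mem_univ _

theorem SmoothCurve.add {c d : ℝ → E} (hc : SmoothCurve c) (hd : SmoothCurve d) :
    SmoothCurve fun t => c t + d t :=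
  smoothCurve_iff.2 fun l => by simpa using (hc.contDiff l).add (hd.contDiff l)

theorem smoothCurve_const (x : E) : SmoothCurve fun _ => x :=
  smoothCurve_iff.2 fun _ => contDiff_const

theorem SmoothCurve.smul {c : ℝ → E} (hc : SmoothCurve c) {h : ℝ → ℝ} (hh : ContDiff ℝ ∞ h) :
    SmoothCurve fun t => h t • c t :=
  smoothCurve_iff.2 fun l => by simpa using hh.mul (hc.contDiff l)

/-- Hadamard's lemma for curves. -/
theorem SmoothCurve.hadamard {c : ℝ → E} (hc : SmoothCurve c) (a : ℝ) :
    ∃ d : ℝ → E, SmoothCurve d ∧ (∀ t, c t = c a + (t - a) • d t) ∧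
      d a = ConvLie.velocity c a := by
  classical
  let d : ℝ → E := fun t => if t = a then ConvLie.velocity c a else (t - a)⁻¹ • (c t - c a)
  refine ⟨d, smoothCurve_iff.2 fun l => ?_, fun t => ?_, by simp [d]⟩
  -- Under every functional the quotient is Hadamard's smooth integral, so `d` is scalarwise smooth
  -- and hence smooth by convenience.
  · suffices e : (fun t => l (d t)) =
        fun t => ∫ σ in (0 : ℝ)..1, deriv (fun t => l (c t)) (a + σ * (t - a)) by
      rw [e]; exact contDiff_hadamard (hc.contDiff l) a
    funext t
    by_cases ht : t = a
    · subst ht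
      simp [d, hc.deriv_apply]
    · have := hadamard_mul (hc.contDiff l) a t
      have h0 : t - a ≠ 0 := sub_ne_zero.2 ht
      simp only [d, if_neg ht, map_smul, map_sub, smul_eq_mul]
      rw [← this]
      field_simp
  · by_cases ht : t = a
    · simp [ht]
    · simp only [d, if_neg ht]
      rw [smul_inv_smul₀ (sub_ne_zero.2 ht)]
      abel

/-- Linear maps which preserve smooth curves commute with velocities. -/
theorem SmoothCurve.velocity_linearMap {F : Type*} [AddCommGroup F] [Module ℝ F]
    [TopologicalSpace F] [ConvenientSpace F] (L : E →ₗ[ℝ] F)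
    (hL : ∀ c : ℝ → E, SmoothCurve c → SmoothCurve fun t => L (c t)) {c : ℝ → E}
    (hc : SmoothCurve c) (a : ℝ) :
    ConvLie.velocity (fun t => L (c t)) a = L (ConvLie.velocity c a) := by
  obtain ⟨d, hd, hcd, hda⟩ := hc.hadamard a
  refine (hL c hc).velocity_eq_of_hasDerivAt fun l => ?_
  -- Continuity of `L` is not available, so the difference quotient is pulled through `L`
  -- algebraically; `L (d s)` is a smooth curve by `hL`.
  have e : (fun s => l (L (c s))) = fun s => l (L (c a)) + (s - a) * l (L (d s)) := by
    funext s
    rw [hcd s]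
    simp
  rw [e, ← hda]
  have h1 := ((hL d hd).contDiff l).differentiable (by simp) a
  have h2 := ((hasDerivAt_id a).sub_const a).mul h1.hasDerivAt
  simpa using h2.const_add (l (L (c a)))

end CurveCalculus

/-! ### Two-parameter maps: partial derivatives and their symmetry. -/

section TwoParameters

variable {E : Type*} [AddCommGroup E] [Module ℝ E] [TopologicalSpace E]

/-- A map of two real parameters is smooth on `W`: it maps smooth curves in `W` to smooth
curves. -/
def SmoothOn2 (f : ℝ × ℝ → E) (W : Set (ℝ × ℝ)) : Prop :=
  ∀ c : ℝ → ℝ × ℝ, ContDiff ℝ ∞ c → (∀ t, c t ∈ W) → SmoothCurve fun t => f (c t)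

theorem SmoothOn2.contDiffOn {f : ℝ × ℝ → E} {W : Set (ℝ × ℝ)} (hf : SmoothOn2 f W)
    (hW : IsOpen W) (l : E →L[ℝ] ℝ) : ContDiffOn ℝ ∞ (fun p => l (f p)) W :=
  contDiffOn_of_smooth_along_curves hW fun c hc hcW => (hf c hc hcW).contDiff l

theorem SmoothOn2.contDiffAt {f : ℝ × ℝ → E} {W : Set (ℝ × ℝ)} (hf : SmoothOn2 f W)
    (hW : IsOpen W) (l : E →L[ℝ] ℝ) {p : ℝ × ℝ} (hp : p ∈ W) :
    ContDiffAt ℝ ∞ (fun p => l (f p)) p :=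
  (hf.contDiffOn hW l).contDiffAt (hW.mem_nhds hp)

theorem SmoothOn2.hasFDerivAt {f : ℝ × ℝ → E} {W : Set (ℝ × ℝ)} (hf : SmoothOn2 f W)
    (hW : IsOpen W) (l : E →L[ℝ] ℝ) {p : ℝ × ℝ} (hp : p ∈ W) :
    HasFDerivAt (fun p => l (f p)) (fderiv ℝ (fun p => l (f p)) p) p :=
  ((hf.contDiffAt hW l hp).differentiableAt (by simp)).hasFDerivAt

variable [ConvenientSpace E]

theorem smoothOn2_of_contDiffOn {f : ℝ × ℝ → E} {W : Set (ℝ × ℝ)}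
    (hf : ∀ l : E →L[ℝ] ℝ, ContDiffOn ℝ ∞ (fun p => l (f p)) W) : SmoothOn2 f W :=
  fun _ hc hcW => smoothCurve_iff.2 fun l => (hf l).comp_contDiff hc hcW

theorem SmoothOn2.hasVelocityAt {f : ℝ × ℝ → E} {W : Set (ℝ × ℝ)} (hf : SmoothOn2 f W)
    (hW : IsOpen W) {c : ℝ → ℝ × ℝ} (hc : ContDiff ℝ ∞ c) {t : ℝ} (ht : c t ∈ W) :
    HasVelocityAt (fun s => f (c s)) (velocity (fun s => f (c s)) t) t := by
  obtain ⟨h, hh, hh1, hh2⟩ := exists_cutoff (hW.preimage hc.continuous) (x := t) ht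
  have h1 : SmoothCurve fun s => f (c (h s)) := hf _ (hc.comp hh) hh2
  have h2 : (fun s => f (c s)) =ᶠ[𝓝 t] fun s => f (c (h s)) := by
    filter_upwards [hh1] with s hs
    rw [hs]
  rw [velocity_congr h2]
  exact (h1.hasVelocityAt t).congr_of_eventuallyEq h2

theorem SmoothOn2.apply_velocity {f : ℝ × ℝ → E} {W : Set (ℝ × ℝ)} (hf : SmoothOn2 f W)
    (hW : IsOpen W) {c : ℝ → ℝ × ℝ} (hc : ContDiff ℝ ∞ c) {t : ℝ} (ht : c t ∈ W)
    (l : E →L[ℝ] ℝ) {w : ℝ × ℝ} (hw : HasDerivAt c w t) :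
    l (velocity (fun s => f (c s)) t) = fderiv ℝ (fun p => l (f p)) (c t) w :=
  ((hf.hasVelocityAt hW hc ht).hasDerivAt l).unique
    ((hf.hasFDerivAt hW l ht).comp_hasDerivAt t hw)

/-- The partial derivative in the second variable. -/
noncomputable def partialSnd (f : ℝ × ℝ → E) (p : ℝ × ℝ) : E :=
  velocity (fun s => f (p.1, s)) p.2

theorem SmoothOn2.apply_partialSnd {f : ℝ × ℝ → E} {W : Set (ℝ × ℝ)} (hf : SmoothOn2 f W)
    (hW : IsOpen W) {p : ℝ × ℝ} (hp : p ∈ W) (l : E →L[ℝ] ℝ) :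
    l (partialSnd f p) = fderiv ℝ (fun p => l (f p)) p (0, 1) :=
  hf.apply_velocity hW (c := fun s => (p.1, s)) (contDiff_const.prodMk contDiff_id) hp l
    ((hasDerivAt_const _ _).prodMk (hasDerivAt_id _))

theorem SmoothOn2.partialSnd {f : ℝ × ℝ → E} {W : Set (ℝ × ℝ)} (hf : SmoothOn2 f W)
    (hW : IsOpen W) : SmoothOn2 (partialSnd f) W :=
  smoothOn2_of_contDiffOn fun l => by
    have h1 : ContDiffOn ℝ ∞ (fun p => fderiv ℝ (fun p => l (f p)) p (0, 1)) W :=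
      ((hf.contDiffOn hW l).fderiv_of_isOpen hW (m := ∞) (by simp)).clm_apply contDiffOn_const
    exact h1.congr fun p hp => hf.apply_partialSnd hW hp l

/-- The derivative along the diagonal is the sum of the partial derivatives. -/
theorem SmoothOn2.velocity_diag {f : ℝ × ℝ → E} {W : Set (ℝ × ℝ)} (hf : SmoothOn2 f W)
    (hW : IsOpen W) {t : ℝ} (ht : (t, t) ∈ W) :
    velocity (fun s => f (s, s)) t =
      velocity (fun s => f (s, t)) t + velocity (fun s => f (t, s)) t :=
  eq_of_functionals fun l => by
    rw [map_add, hf.apply_velocity hW (c := fun s => (s, s)) (contDiff_id.prodMk contDiff_id) ht l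
        ((hasDerivAt_id t).prodMk (hasDerivAt_id t)),
      hf.apply_velocity hW (c := fun s => (s, t)) (contDiff_id.prodMk contDiff_const) ht l
        ((hasDerivAt_id t).prodMk (hasDerivAt_const t t)),
      hf.apply_velocity hW (c := fun s => (t, s)) (contDiff_const.prodMk contDiff_id) ht l
        ((hasDerivAt_const t t).prodMk (hasDerivAt_id t)), ← map_add]
    simp

/-- Symmetry of the mixed second derivatives. -/
theorem SmoothOn2.partial_comm {f : ℝ × ℝ → E} {W : Set (ℝ × ℝ)} (hf : SmoothOn2 f W)
    (hW : IsOpen W) {a b : ℝ} (hab : (a, b) ∈ W) :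
    velocity (fun s => velocity (fun t => f (s, t)) b) a =
      velocity (fun t => velocity (fun s => f (s, t)) a) b := by
  -- Swapping the variables gives the first partial derivative from results about the second.
  have hf' : SmoothOn2 (fun p => f p.swap) (Prod.swap ⁻¹' W) := fun c hc hcW =>
    hf (fun t => (c t).swap) (hc.snd.prodMk hc.fst) hcW
  have hW' : IsOpen (Prod.swap ⁻¹' W) := hW.preimage continuous_swap
  refine eq_of_functionals fun l => ?_
  set g : ℝ × ℝ → ℝ := fun p => l (f p) with hg
  have hgd : ContDiffAt ℝ ∞ g (a, b) := hf.contDiffAt hW l hab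
  have h1 : l (velocity (fun s => velocity (fun t => f (s, t)) b) a) =
      fderiv ℝ (fun p => fderiv ℝ g p (0, 1)) (a, b) (1, 0) := by
    have := (hf.partialSnd hW).apply_velocity hW (c := fun s => (s, b))
      (contDiff_id.prodMk contDiff_const) hab l ((hasDerivAt_id a).prodMk (hasDerivAt_const a b))
    refine this.trans ?_
    congr 1
    refine Filter.EventuallyEq.fderiv_eq ?_
    filter_upwards [hW.mem_nhds hab] with p hp using hf.apply_partialSnd hW hp l
  have h2 : l (velocity (fun t => velocity (fun s => f (s, t)) a) b) =
      fderiv ℝ (fun p => fderiv ℝ g p (1, 0)) (a, b) (0, 1) := by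
    have hcont : ContDiff ℝ ∞ fun t : ℝ => (t, a) := contDiff_id.prodMk contDiff_const
    have hv := ((hf'.partialSnd hW').hasVelocityAt hW' hcont (t := b) hab).hasDerivAt l
    have hgg : DifferentiableAt ℝ (fun p => fderiv ℝ g p (1, 0)) (a, b) :=
      ((hgd.fderiv_right (m := ∞) (by simp)).clm_apply contDiffAt_const).differentiableAt (by simp)
    have hw := hgg.hasFDerivAt.comp_hasDerivAt b
      ((hasDerivAt_const b a).prodMk (hasDerivAt_id b))
    refine hv.unique (hw.congr_of_eventuallyEq ?_)
    have hn : ∀ᶠ t in 𝓝 b, (a, t) ∈ W :=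
      (Continuous.prodMk_right a).continuousAt.eventually_mem (hW.mem_nhds hab)
    filter_upwards [hn] with t ht
    exact hf.apply_velocity hW (c := fun s => (s, t)) (contDiff_id.prodMk contDiff_const) ht l
      ((hasDerivAt_id a).prodMk (hasDerivAt_const a t))
  have hd : DifferentiableAt ℝ (fderiv ℝ g) (a, b) :=
    (hgd.fderiv_right (m := ∞) (by simp)).differentiableAt (by simp)
  have h3 : ∀ v w : ℝ × ℝ, fderiv ℝ (fun p => fderiv ℝ g p v) (a, b) w =
      fderiv ℝ (fderiv ℝ g) (a, b) w v := fun v w => by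
    have := (hd.hasFDerivAt.clm_apply (hasFDerivAt_const v (a, b))).fderiv
    rw [this]
    simp
  rw [h1, h2, h3, h3]
  refine (hgd.isSymmSndFDerivAt ?_).eq _ _
  rw [minSmoothness_of_isRCLikeNormedField]
  exact WithTop.coe_le_coe.2 (le_top : (2 : ℕ∞) ≤ ⊤)

end TwoParameters

/-! ### Smooth curves and two-parameter maps in manifolds. -/

section ManifoldCurves

variable {E : Type*} [AddCommGroup E] [Module ℝ E] [TopologicalSpace E] [ConvenientSpace E]
  {M : Type*} [ConvenientManifold E M]

theorem msmoothCurve_of_charts {c : ℝ → M}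
    (h : ∀ t, ∃ φ ∈ ConvenientManifold.atlas (E := E) (M := M), ∃ d : ℝ → E, SmoothCurve d ∧
      (∀ s, d s ∈ φ.target) ∧ c =ᶠ[𝓝 t] fun s => φ.symm (d s)) : MSmoothCurve E c := by
  intro t
  obtain ⟨φ, hφ, d, hd, hdt, hc⟩ := h t
  obtain ⟨J, hJc, hJ, htJ⟩ := eventually_nhds_iff.1 hc
  refine ⟨φ, hφ, J, hJ, htJ, fun s hs => ?_, (hd.smoothCurveOn J).congr hJ fun s hs => ?_⟩
  · rw [hJc s hs]; exact φ.map_target (hdt s)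
  · rw [hJc s hs, φ.right_inv (hdt s)]

/-- The cutoff replaces local smoothness by a curve in the chart image defined on all of ℝ, the form
required by the axioms for chart changes. -/
theorem MSmoothCurve.exists_chart {c : ℝ → M} (hc : MSmoothCurve E c) (t : ℝ) :
    ∃ φ ∈ ConvenientManifold.atlas (E := E) (M := M), ∃ d : ℝ → E, SmoothCurve d ∧
      (∀ s, d s ∈ φ.target) ∧ c =ᶠ[𝓝 t] fun s => φ.symm (d s) := by
  obtain ⟨φ, hφ, J, hJ, htJ, hJs, hd⟩ := hc t
  obtain ⟨h, hh, hh1, hh2⟩ := exists_cutoff hJ htJ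
  refine ⟨φ, hφ, fun s => φ (c (h s)), hd.comp hJ hh hh2, fun s => φ.map_source (hJs _ (hh2 s)), ?_⟩
  filter_upwards [hh1, hJ.mem_nhds htJ] with s hs hsJ
  rw [hs, φ.left_inv (hJs s hsJ)]

theorem MSmoothCurve.comp {c : ℝ → M} (hc : MSmoothCurve E c) {h : ℝ → ℝ}
    (hh : ContDiff ℝ ∞ h) : MSmoothCurve E fun t => c (h t) :=
  msmoothCurve_of_charts fun t => by
    obtain ⟨φ, hφ, d, hd, hdt, hcd⟩ := hc.exists_chart (h t)
    exact ⟨φ, hφ, fun s => d (h s), hd.comp hh, fun s => hdt _,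
      hh.continuous.continuousAt.eventually hcd⟩

theorem SmoothCurve.msmoothCurve {φ : PartialEquiv M E}
    (hφ : φ ∈ ConvenientManifold.atlas (E := E) (M := M)) {d : ℝ → E} (hd : SmoothCurve d)
    (hdt : ∀ s, d s ∈ φ.target) : MSmoothCurve E fun s => φ.symm (d s) :=
  msmoothCurve_of_charts fun _ => ⟨φ, hφ, d, hd, hdt, EventuallyEq.rfl⟩

theorem msmoothCurve_const (x : M) : MSmoothCurve E fun _ : ℝ => x := by
  have h := SmoothCurve.msmoothCurve (M := M) (ConvenientManifold.chartAt_mem (E := E) x)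
    (smoothCurve_const (ConvenientManifold.chartAt (E := E) x x))
    (fun _ => (ConvenientManifold.chartAt (E := E) x).map_source
      (ConvenientManifold.mem_chartAt_source x))
  simpa only [(ConvenientManifold.chartAt (E := E) x).left_inv
    (ConvenientManifold.mem_chartAt_source x)] using h

/-- Near a time where it lies in the domain of a given chart, a smooth curve is smooth in this
chart. -/
theorem MSmoothCurve.exists_of_mem_source {c : ℝ → M} (hc : MSmoothCurve E c) {t : ℝ}
    {φ : PartialEquiv M E} (hφ : φ ∈ ConvenientManifold.atlas (E := E) (M := M))
    (ht : c t ∈ φ.source) : ∃ d : ℝ → E, SmoothCurve d ∧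
      (∀ s, d s ∈ φ.target) ∧ c =ᶠ[𝓝 t] fun s => φ.symm (d s) := by
  obtain ⟨ψ, hψ, d, hd, hdt, hcd⟩ := hc.exists_chart t
  have hO : IsOpen (d ⁻¹' (ψ '' (ψ.source ∩ φ.source))) :=
    ConvenientManifold.open_overlap ψ hψ φ hφ d hd
  have htO : t ∈ d ⁻¹' (ψ '' (ψ.source ∩ φ.source)) := by
    have h1 : c t = ψ.symm (d t) := hcd.self_of_nhds
    refine ⟨c t, ⟨?_, ht⟩, ?_⟩
    · rw [h1]; exact ψ.map_target (hdt t)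
    · rw [h1, ψ.right_inv (hdt t)]
  have hsrc : ∀ s ∈ d ⁻¹' (ψ '' (ψ.source ∩ φ.source)), ψ.symm (d s) ∈ φ.source := by
    rintro s ⟨x, hx, hxs⟩
    rw [← hxs, ψ.left_inv hx.1]
    exact hx.2
  obtain ⟨h, hh, hh1, hh2⟩ := exists_cutoff hO htO
  refine ⟨fun s => φ (ψ.symm (d (h s))), ConvenientManifold.smooth_change ψ hψ φ hφ
    (fun s => d (h s)) (hd.comp hh) hh2, fun s => φ.map_source (hsrc _ (hh2 s)), ?_⟩
  filter_upwards [hcd, hh1, hO.mem_nhds htO] with s h1 h2 h3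
  rw [h2, φ.left_inv (hsrc s h3), h1]

theorem MSmoothCurve.isOpen_preimage_source {c : ℝ → M} (hc : MSmoothCurve E c)
    {φ : PartialEquiv M E} (hφ : φ ∈ ConvenientManifold.atlas (E := E) (M := M)) :
    IsOpen (c ⁻¹' φ.source) := by
  rw [isOpen_iff_mem_nhds]
  intro t ht
  obtain ⟨d, -, hdt, hcd⟩ := hc.exists_of_mem_source hφ ht
  filter_upwards [hcd] with s hs
  rw [mem_preimage, hs]
  exact φ.map_target (hdt s)

theorem MSmoothCurve.smoothCurve_chart {c : ℝ → M} (hc : MSmoothCurve E c)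
    {φ : PartialEquiv M E} (hφ : φ ∈ ConvenientManifold.atlas (E := E) (M := M))
    (h : ∀ t, c t ∈ φ.source) : SmoothCurve fun t => φ (c t) :=
  SmoothCurve.of_local fun t => by
    obtain ⟨d, hd, hdt, hcd⟩ := hc.exists_of_mem_source hφ (h t)
    refine ⟨d, hd, ?_⟩
    filter_upwards [hcd] with s hs
    rw [hs, φ.right_inv (hdt s)]

theorem cInftyOpen_target {φ : PartialEquiv M E}
    (hφ : φ ∈ ConvenientManifold.atlas (E := E) (M := M)) : CInftyOpen φ.target := by
  have := ConvenientManifold.open_overlap φ hφ φ hφ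
  rwa [inter_self, φ.image_source_eq_target] at this

variable (E) in
/-- A map of two real parameters into a manifold is smooth on `W`: it maps smooth curves in `W`
to smooth curves. -/
def MSmoothOn2 (q : ℝ × ℝ → M) (W : Set (ℝ × ℝ)) : Prop :=
  ∀ c : ℝ → ℝ × ℝ, ContDiff ℝ ∞ c → (∀ t, c t ∈ W) → MSmoothCurve E fun t => q (c t)

/-- An arbitrary curve becomes a curve in W after a cutoff reparametrisation near a given time, so
testing openness on curves in W is enough. -/
theorem isOpen_of_curves_in {A W : Set (ℝ × ℝ)} (hW : IsOpen W)
    (h : ∀ c : ℝ → ℝ × ℝ, ContDiff ℝ ∞ c → (∀ t, c t ∈ W) → IsOpen (c ⁻¹' A)) :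
    IsOpen (W ∩ A) := by
  refine isOpen_of_preimage_curves fun c hc => isOpen_iff_mem_nhds.2 fun t ht => ?_
  obtain ⟨g, hg, hg1, hg2⟩ := exists_cutoff (hW.preimage hc.continuous) (x := t) ht.1
  have h1 : (fun s => c (g s)) ⁻¹' A ∈ 𝓝 t :=
    (h _ (hc.comp hg) hg2).mem_nhds (by
      have := ht.2
      simpa only [mem_preimage, Function.comp_apply, hg1.self_of_nhds] using this)
  filter_upwards [h1, hg1, (hW.preimage hc.continuous).mem_nhds ht.1] with s h2 h3 h4
  refine ⟨h4, ?_⟩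
  simpa only [mem_preimage, h3] using h2

theorem SmoothOn2.isOpen_inter_preimage {f : ℝ × ℝ → E} {W : Set (ℝ × ℝ)} (hf : SmoothOn2 f W)
    (hW : IsOpen W) {U : Set E} (hU : CInftyOpen U) : IsOpen (W ∩ f ⁻¹' U) :=
  isOpen_of_curves_in hW fun c hc hcW => hU _ (hf c hc hcW)

theorem MSmoothOn2.isOpen_inter_source {q : ℝ × ℝ → M} {W : Set (ℝ × ℝ)}
    (hq : MSmoothOn2 E q W) (hW : IsOpen W) {φ : PartialEquiv M E}
    (hφ : φ ∈ ConvenientManifold.atlas (E := E) (M := M)) : IsOpen (W ∩ q ⁻¹' φ.source) :=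
  isOpen_of_curves_in hW fun c hc hcW => (hq c hc hcW).isOpen_preimage_source hφ

theorem MSmoothOn2.smoothOn2_chart {q : ℝ × ℝ → M} {W : Set (ℝ × ℝ)}
    (hq : MSmoothOn2 E q W) {φ : PartialEquiv M E}
    (hφ : φ ∈ ConvenientManifold.atlas (E := E) (M := M)) :
    SmoothOn2 (fun p => φ (q p)) (W ∩ q ⁻¹' φ.source) := fun c hc hcW =>
  (hq c hc fun t => (hcW t).1).smoothCurve_chart hφ fun t => (hcW t).2

theorem SmoothOn2.msmoothOn2 {f : ℝ × ℝ → E} {W : Set (ℝ × ℝ)} (hf : SmoothOn2 f W)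
    {φ : PartialEquiv M E} (hφ : φ ∈ ConvenientManifold.atlas (E := E) (M := M))
    (h : ∀ p ∈ W, f p ∈ φ.target) : MSmoothOn2 E (fun p => φ.symm (f p)) W := fun c hc hcW =>
  (hf c hc hcW).msmoothCurve hφ fun s => h _ (hcW s)

theorem MSmoothCurve.msmoothOn2 {c : ℝ → M} (hc : MSmoothCurve E c) {h : ℝ × ℝ → ℝ}
    (hh : ContDiff ℝ ∞ h) (W : Set (ℝ × ℝ)) : MSmoothOn2 E (fun p => c (h p)) W :=
  fun _ he _ => hc.comp (hh.comp he)

theorem MSmoothOn2.comp {q : ℝ × ℝ → M} {W W' : Set (ℝ × ℝ)} (hq : MSmoothOn2 E q W)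
    {h : ℝ × ℝ → ℝ × ℝ} (hh : ContDiff ℝ ∞ h) (hW : ∀ p ∈ W', h p ∈ W) :
    MSmoothOn2 E (fun p => q (h p)) W' :=
  fun c hc hcW => hq (fun t => h (c t)) (hh.comp hc) fun t => hW _ (hcW t)

end ManifoldCurves

/-! ### Tangent vectors at the identity and the chain rule. -/

section LieGroupTangent

variable {E : Type*} [AddCommGroup E] [Module ℝ E] [TopologicalSpace E] [ConvenientSpace E]
  {G : Type*} [Group G] [ConvenientLieGroup E G]

theorem MSmoothOn2.mul {q r : ℝ × ℝ → G} {W : Set (ℝ × ℝ)} (hq : MSmoothOn2 E q W)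
    (hr : MSmoothOn2 E r W) : MSmoothOn2 E (fun p => q p * r p) W := fun c hc hcW =>
  ConvenientLieGroup.smooth_mul _ _ (hq c hc hcW) (hr c hc hcW)

theorem MSmoothOn2.inv {q : ℝ × ℝ → G} {W : Set (ℝ × ℝ)} (hq : MSmoothOn2 E q W) :
    MSmoothOn2 E (fun p => (q p)⁻¹) W := fun c hc hcW =>
  ConvenientLieGroup.smooth_inv _ (hq c hc hcW)

variable (E G) in
theorem chartOne_mem : chartOne E G ∈ ConvenientManifold.atlas (E := E) (M := G) :=
  ConvenientManifold.chartAt_mem _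

variable (E G) in
theorem one_mem_source : (1 : G) ∈ (chartOne E G).source :=
  ConvenientManifold.mem_chartAt_source _

variable (E) in
/-- The tangent vector at time `t` of a curve which passes through `1` at that time. -/
noncomputable def tangent (c : ℝ → G) (t : ℝ) : E := velocity (fun s => chartOne E G (c s)) t

theorem tangent_congr {c d : ℝ → G} {t : ℝ} (h : c =ᶠ[𝓝 t] d) : tangent E c t = tangent E d t :=
  velocity_congr (h.fun_comp (chartOne E G))

theorem MSmoothCurve.hasVelocityAt_tangent {c : ℝ → G} (hc : MSmoothCurve E c) {t : ℝ}
    (h1 : c t = 1) : HasVelocityAt (fun s => chartOne E G (c s)) (tangent E c t) t := by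
  obtain ⟨d, hd, hdt, hcd⟩ := hc.exists_of_mem_source (chartOne_mem E G) (t := t)
    (by rw [h1]; exact one_mem_source E G)
  have h2 : (fun s => chartOne E G (c s)) =ᶠ[𝓝 t] d := by
    filter_upwards [hcd] with s hs
    rw [hs, (chartOne E G).right_inv (hdt s)]
  rw [tangent, velocity_congr h2]
  exact (hd.hasVelocityAt t).congr_of_eventuallyEq h2

/-- Smooth dependence of tangent vectors on a parameter. -/
theorem MSmoothOn2.smoothCurve_tangent {q : ℝ × ℝ → G} {W : Set (ℝ × ℝ)}
    (hq : MSmoothOn2 E q W) (hW : IsOpen W) (h0 : ∀ r, (r, 0) ∈ W) (h1 : ∀ r, q (r, 0) = 1) :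
    SmoothCurve fun r => tangent E (fun τ => q (r, τ)) 0 := by
  have h2 := (hq.smoothOn2_chart (chartOne_mem E G)).partialSnd
    (hq.isOpen_inter_source hW (chartOne_mem E G))
  refine h2 (fun r => (r, 0)) (contDiff_id.prodMk contDiff_const) fun r => ⟨h0 r, ?_⟩
  rw [mem_preimage, h1]
  exact one_mem_source E G

variable (E G) in
/-- The set of parameters where a straight line lies in the domain of the inverse chart. -/
theorem isOpen_line_mem_target {d : ℝ → E} (hd : SmoothCurve d) :
    IsOpen {p : ℝ × ℝ | chartOne E G 1 + p.2 • d p.1 ∈ (chartOne E G).target} := by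
  have hf : SmoothOn2 (fun p : ℝ × ℝ => chartOne E G 1 + p.2 • d p.1) univ := fun c hc _ =>
    (smoothCurve_const _).add ((hd.comp hc.fst).smul hc.snd)
  have := hf.isOpen_inter_preimage isOpen_univ (cInftyOpen_target (chartOne_mem E G))
  rwa [univ_inter] at this

variable (G) in
theorem msmoothOn2_line {d : ℝ → E} (hd : SmoothCurve d) :
    MSmoothOn2 E (fun p : ℝ × ℝ => lineOne E G (d p.1) p.2)
      {p : ℝ × ℝ | chartOne E G 1 + p.2 • d p.1 ∈ (chartOne E G).target} := by
  have hf : SmoothOn2 (fun p : ℝ × ℝ => chartOne E G 1 + p.2 • d p.1)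
      {p : ℝ × ℝ | chartOne E G 1 + p.2 • d p.1 ∈ (chartOne E G).target} := fun c hc _ =>
    (smoothCurve_const _).add ((hd.comp hc.fst).smul hc.snd)
  exact hf.msmoothOn2 (chartOne_mem E G) fun p hp => hp

theorem lineOne_zero (x : E) : lineOne E G x 0 = 1 := by
  simp [lineOne, (chartOne E G).left_inv (one_mem_source E G)]

theorem chartOne_add_zero_smul_mem (x : E) :
    chartOne E G 1 + (0 : ℝ) • x ∈ (chartOne E G).target := by
  rw [zero_smul, add_zero]
  exact (chartOne E G).map_source (one_mem_source E G)

variable (G) in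
/-- There is a globally defined smooth curve which is affine near `0`. -/
theorem exists_msmoothCurve_lineOne (x : E) : ∃ σ : ℝ → G, MSmoothCurve E σ ∧ σ 0 = 1 ∧
    σ =ᶠ[𝓝 0] lineOne E G x := by
  obtain ⟨h, hh, hh1, hh2⟩ := exists_cutoff (isOpen_line_mem_target E G (smoothCurve_const x))
    (x := ((0 : ℝ), (0 : ℝ))) (chartOne_add_zero_smul_mem x)
  have hc : ContDiff ℝ ∞ fun s : ℝ => h (0, s) := hh.comp (contDiff_const.prodMk contDiff_id)
  have he : ∀ᶠ s : ℝ in 𝓝 0, h (0, s) = (0, s) :=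
    (Continuous.prodMk_right (0 : ℝ)).continuousAt.eventually hh1
  refine ⟨fun s => lineOne E G x (h (0, s)).2,
    msmoothOn2_line G (smoothCurve_const x) _ hc fun s => hh2 _, ?_, ?_⟩
  · simp only [he.self_of_nhds]
    exact lineOne_zero x
  · filter_upwards [he] with s hs
    rw [hs]

theorem tangent_lineOne (x : E) : tangent E (lineOne E G x) 0 = x := by
  obtain ⟨h, -, hh1, hh2⟩ := exists_cutoff (isOpen_line_mem_target E G (smoothCurve_const x))
    (x := ((0 : ℝ), (0 : ℝ))) (chartOne_add_zero_smul_mem x)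
  have he : ∀ᶠ s : ℝ in 𝓝 0, h (0, s) = (0, s) :=
    (Continuous.prodMk_right (0 : ℝ)).continuousAt.eventually hh1
  have h2 : (fun s => chartOne E G (lineOne E G x s)) =ᶠ[𝓝 0]
      fun s => chartOne E G 1 + s • x := by
    filter_upwards [he] with s hs
    have := hh2 (0, s)
    rw [hs] at this
    exact (chartOne E G).right_inv this
  rw [tangent, velocity_congr h2]
  refine ((smoothCurve_const _).add
    ((smoothCurve_const x).smul contDiff_id)).velocity_eq_of_hasDerivAt fun l => ?_
  simpa using ((hasDerivAt_id (0 : ℝ)).mul_const (l x)).const_add (l (chartOne E G 1))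

/-- A map of two parameters that interpolates between a smooth curve through `1` and its tangent
line. -/
theorem MSmoothCurve.exists_interpolation {c : ℝ → G} (hc : MSmoothCurve E c) (h1 : c 0 = 1) :
    ∃ q : ℝ × ℝ → G, MSmoothOn2 E q univ ∧ q (0, 0) = 1 ∧ (∀ᶠ t in 𝓝 0, q (t, t) = c t) ∧
      (∀ᶠ t in 𝓝 0, q (0, t) = 1) ∧
      ∀ᶠ s in 𝓝 0, q (s, 0) = lineOne E G (tangent E c 0) s := by
  obtain ⟨d, hd, hdt, hcd⟩ := hc.exists_of_mem_source (chartOne_mem E G) (t := 0)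
    (by rw [h1]; exact one_mem_source E G)
  have h2 : (fun s => chartOne E G (c s)) =ᶠ[𝓝 0] d := by
    filter_upwards [hcd] with s hs
    rw [hs, (chartOne E G).right_inv (hdt s)]
  have hd0 : d 0 = chartOne E G 1 := by simp only [← h2.self_of_nhds, h1]
  obtain ⟨e, he, hde, he0⟩ := hd.hadamard 0
  have he0' : e 0 = tangent E c 0 := by rw [he0, tangent, velocity_congr h2]
  obtain ⟨h, hh, hh1, hh2⟩ := exists_cutoff (isOpen_line_mem_target E G he)
    (x := ((0 : ℝ), (0 : ℝ))) (chartOne_add_zero_smul_mem _)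
  -- Hadamard's lemma writes c as φ⁻¹(φ(1) + t e(t)) in the chart φ = `chartOne`. Decoupling the two
  -- occurrences of t gives q(s, t) = φ⁻¹(φ(1) + s e(t)).
  refine ⟨fun p => lineOne E G (e (h p.swap).1) (h p.swap).2, fun c hc _ =>
    msmoothOn2_line G he _ (hh.comp (hc.snd.prodMk hc.fst)) fun t => hh2 _, ?_, ?_, ?_, ?_⟩
  · simp only [Prod.swap_prod_mk, hh1.self_of_nhds]
    exact lineOne_zero _
  · have : ∀ᶠ t : ℝ in 𝓝 0, h (t, t) = (t, t) :=
      (show Continuous fun t : ℝ => (t, t) by fun_prop).continuousAt.eventually hh1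
    filter_upwards [this, hcd] with t ht htc
    rw [Prod.swap_prod_mk, ht, htc, hde t, hd0, sub_zero, lineOne]
  · have : ∀ᶠ t : ℝ in 𝓝 0, h (t, 0) = (t, 0) :=
      (Continuous.prodMk_left (0 : ℝ)).continuousAt.eventually hh1
    filter_upwards [this] with t ht
    rw [Prod.swap_prod_mk, ht]
    exact lineOne_zero _
  · have : ∀ᶠ t : ℝ in 𝓝 0, h (0, t) = (0, t) :=
      (Continuous.prodMk_right (0 : ℝ)).continuousAt.eventually hh1
    filter_upwards [this] with t ht
    rw [Prod.swap_prod_mk, ht, he0']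

variable {F : Type*} [AddCommGroup F] [Module ℝ F] [TopologicalSpace F] [ConvenientSpace F]

variable (E) in
/-- A map from a Lie group to a vector space is smooth near `1`. -/
def SmoothNearOne (H : G → F) : Prop :=
  ∀ q : ℝ × ℝ → G, MSmoothOn2 E q univ → q (0, 0) = 1 →
    ∃ W : Set (ℝ × ℝ), IsOpen W ∧ (0, 0) ∈ W ∧ SmoothOn2 (fun p => H (q p)) W

/-- The chain rule: the velocity of `H ∘ c` depends only on the tangent vector of `c`. -/
theorem SmoothNearOne.velocity_comp {H : G → F} (hH : SmoothNearOne E H) {c : ℝ → G}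
    (hc : MSmoothCurve E c) (h1 : c 0 = 1) :
    velocity (fun s => H (c s)) 0 = velocity (fun s => H (lineOne E G (tangent E c 0) s)) 0 := by
  obtain ⟨q, hq, hq0, hqd, hq1, hq2⟩ := hc.exists_interpolation h1
  obtain ⟨W, hW, h0W, hs⟩ := hH q hq hq0
  -- The diagonal derivative of H ∘ q is the sum of its partial derivatives; the one along q(0, t) =
  -- 1 vanishes, and the other is the derivative along the tangent line.
  have e1 : (fun s => H (c s)) =ᶠ[𝓝 0] fun s => H (q (s, s)) := by
    filter_upwards [hqd] with s hs using by rw [hs]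
  have e2 : (fun s => H (lineOne E G (tangent E c 0) s)) =ᶠ[𝓝 0] fun s => H (q (s, 0)) := by
    filter_upwards [hq2] with s hs using by rw [hs]
  have e3 : (fun s => H (q (0, s))) =ᶠ[𝓝 0] fun _ => H 1 := by
    filter_upwards [hq1] with s hs using by rw [hs]
  rw [velocity_congr e1, velocity_congr e2, hs.velocity_diag hW h0W, velocity_congr e3,
    (smoothCurve_const (H 1)).velocity_eq_of_hasDerivAt (v := 0)
      (fun l => by simpa using hasDerivAt_const (0 : ℝ) (l (H 1))), add_zero]

theorem smoothNearOne_chart_comp {M : Type*} [ConvenientManifold F M] {g : G → M}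
    (hg : ∀ c : ℝ → G, MSmoothCurve E c → MSmoothCurve F fun t => g (c t)) {ψ : PartialEquiv M F}
    (hψ : ψ ∈ ConvenientManifold.atlas (E := F) (M := M)) (h1 : g 1 ∈ ψ.source) :
    SmoothNearOne E fun a => ψ (g a) := by
  intro q hq hq0
  have h2 : MSmoothOn2 F (fun p => g (q p)) univ := fun c hc hcW => hg _ (hq c hc hcW)
  refine ⟨_, h2.isOpen_inter_source isOpen_univ hψ, ⟨mem_univ _, ?_⟩, h2.smoothOn2_chart hψ⟩
  rw [mem_preimage, hq0]
  exact h1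

/-- Product rule for tangent vectors at `1`. -/
theorem tangent_mul {c d : ℝ → G} (hc : MSmoothCurve E c) (hd : MSmoothCurve E d) {t : ℝ}
    (hc1 : c t = 1) (hd1 : d t = 1) :
    tangent E (fun s => c s * d s) t = tangent E c t + tangent E d t := by
  have hq : MSmoothOn2 E (fun p : ℝ × ℝ => c p.1 * d p.2) univ :=
    (hc.msmoothOn2 contDiff_fst _).mul (hd.msmoothOn2 contDiff_snd _)
  have := (hq.smoothOn2_chart (chartOne_mem E G)).velocity_diag
    (hq.isOpen_inter_source isOpen_univ (chartOne_mem E G)) (t := t) ⟨mem_univ _, by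
      simpa [hc1, hd1] using one_mem_source E G⟩
  simp only [hc1, hd1, one_mul, mul_one] at this
  exact this

theorem tangent_const (t : ℝ) : tangent E (fun _ => (1 : G)) t = 0 :=
  (smoothCurve_const _).velocity_eq_of_hasDerivAt fun l => by
    simpa using hasDerivAt_const t (l (chartOne E G 1))

theorem tangent_inv {c : ℝ → G} (hc : MSmoothCurve E c) {t : ℝ} (hc1 : c t = 1) :
    tangent E (fun s => (c s)⁻¹) t = -tangent E c t := by
  have := tangent_mul hc (ConvenientLieGroup.smooth_inv c hc) hc1 (by simp [hc1])
  simp only [mul_inv_cancel, tangent_const] at this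
  exact (neg_eq_of_add_eq_zero_right this.symm).symm

/-- Chain rule for tangent vectors at `1`. -/
theorem tangent_comp {c : ℝ → G} (hc : MSmoothCurve E c) (h1 : c 0 = 1)
    {h : ℝ → ℝ} (hh : ContDiff ℝ ∞ h) (h0 : h 0 = 0) {a : ℝ} (ha : HasDerivAt h a 0) :
    tangent E (fun s => c (h s)) 0 = a • tangent E c 0 := by
  refine eq_of_functionals fun l => ?_
  have hv := ((hc.comp hh).hasVelocityAt_tangent (t := 0) (by rw [h0, h1])).hasDerivAt l
  have hv' := (hc.hasVelocityAt_tangent h1).hasDerivAt l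
  rw [← h0] at hv'
  have := hv.unique (hv'.comp (0 : ℝ) ha)
  rw [this, h0, map_smul, smul_eq_mul, mul_comm]

theorem tangent_shift {c : ℝ → G} (hc : MSmoothCurve E c) {t : ℝ} (h1 : c t = 1) :
    tangent E (fun s => c (t + s)) 0 = tangent E c t := by
  have := ((hc.hasVelocityAt_tangent h1).hasVelocityAt_shift).velocity_eq
  exact this

end LieGroupTangent

/-! ### Elementary differentiation rules. -/

section Velocity

variable {E : Type*} [AddCommGroup E] [Module ℝ E] [TopologicalSpace E] [ConvenientSpace E]

theorem velocity_const (x : E) (t : ℝ) : velocity (fun _ : ℝ => x) t = 0 :=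
  (smoothCurve_const x).velocity_eq_of_hasDerivAt fun l => by
    simpa using hasDerivAt_const t (l x)

theorem velocity_add {c d : ℝ → E} (hc : SmoothCurve c) (hd : SmoothCurve d) (t : ℝ) :
    velocity (fun s => c s + d s) t = velocity c t + velocity d t :=
  (hc.add hd).velocity_eq_of_hasDerivAt fun l => by
    simp only [map_add]
    exact ((hc.hasVelocityAt t).hasDerivAt l).add ((hd.hasVelocityAt t).hasDerivAt l)

theorem velocity_smul {c : ℝ → E} (hc : SmoothCurve c) {h : ℝ → ℝ} (hh : ContDiff ℝ ∞ h) (t : ℝ) :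
    velocity (fun s => h s • c s) t = deriv h t • c t + h t • velocity c t :=
  (hc.smul hh).velocity_eq_of_hasDerivAt fun l => by
    simp only [map_add, map_smul, smul_eq_mul]
    exact (hh.differentiable (by simp) t).hasDerivAt.mul ((hc.hasVelocityAt t).hasDerivAt l)

end Velocity

/-! ### The adjoint action and the Lie bracket. -/

section Adjoint

variable {E : Type*} [AddCommGroup E] [Module ℝ E] [TopologicalSpace E] [ConvenientSpace E]
  {G : Type*} [Group G] [ConvenientLieGroup E G]

theorem MSmoothCurve.const_mul {c : ℝ → G} (hc : MSmoothCurve E c) (a : G) :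
    MSmoothCurve E fun t => a * c t :=
  ConvenientLieGroup.smooth_mul _ _ (msmoothCurve_const a) hc

theorem MSmoothCurve.mul_const {c : ℝ → G} (hc : MSmoothCurve E c) (a : G) :
    MSmoothCurve E fun t => c t * a :=
  ConvenientLieGroup.smooth_mul _ _ hc (msmoothCurve_const a)

theorem MSmoothCurve.conj {c : ℝ → G} (hc : MSmoothCurve E c) (a : G) :
    MSmoothCurve E fun t => a * c t * a⁻¹ :=
  (hc.const_mul a).mul_const a⁻¹

variable (G) in
theorem exists_msmoothCurve_tangent (x : E) : ∃ σ : ℝ → G, MSmoothCurve E σ ∧ σ 0 = 1 ∧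
    tangent E σ 0 = x := by
  obtain ⟨σ, hσ, h0, h1⟩ := exists_msmoothCurve_lineOne G x
  exact ⟨σ, hσ, h0, by rw [tangent_congr h1, tangent_lineOne]⟩

/-- By the chain rule Ad can be computed along any smooth curve with the given tangent, not only
along chart lines; group identities for curves then become identities for Ad. -/
theorem tangent_conj {c : ℝ → G} (hc : MSmoothCurve E c) (h1 : c 0 = 1) (a : G) :
    tangent E (fun s => a * c s * a⁻¹) 0 = Ad E a (tangent E c 0) :=
  (smoothNearOne_chart_comp (E := E) (g := fun b : G => a * b * a⁻¹) (fun _ hc => hc.conj a)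
    (chartOne_mem E G) (by simpa using one_mem_source E G)).velocity_comp hc h1

theorem Ad_add (a : G) (x y : E) : Ad E a (x + y) = Ad E a x + Ad E a y := by
  obtain ⟨c, hc, hc0, rfl⟩ := exists_msmoothCurve_tangent G x
  obtain ⟨d, hd, hd0, rfl⟩ := exists_msmoothCurve_tangent G y
  rw [← tangent_mul hc hd hc0 hd0, ← tangent_conj hc hc0, ← tangent_conj hd hd0,
    ← tangent_mul (hc.conj a) (hd.conj a) (by simp [hc0]) (by simp [hd0]),
    ← tangent_conj (ConvenientLieGroup.smooth_mul _ _ hc hd) (by simp [hc0, hd0])]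
  congr 1
  funext s
  group

theorem Ad_smul (a : G) (r : ℝ) (x : E) : Ad E a (r • x) = r • Ad E a x := by
  obtain ⟨c, hc, hc0, rfl⟩ := exists_msmoothCurve_tangent G x
  have hh : ContDiff ℝ ∞ fun s : ℝ => r * s := contDiff_const.mul contDiff_id
  have h0 : (fun s : ℝ => r * s) 0 = 0 := by simp
  have hd : HasDerivAt (fun s : ℝ => r * s) r 0 := by
    simpa using (hasDerivAt_id (0 : ℝ)).const_mul r
  rw [← tangent_comp hc hc0 hh h0 hd, ← tangent_conj hc hc0,
    ← tangent_comp (hc.conj a) (by simp [hc0]) hh h0 hd,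
    ← tangent_conj (hc.comp hh) (by simp [hc0])]

variable (E) in
/-- The adjoint action as a linear map. -/
noncomputable def AdLinear (a : G) : E →ₗ[ℝ] E where
  toFun := Ad E a
  map_add' := Ad_add a
  map_smul' := Ad_smul a

theorem Ad_sub (a : G) (x y : E) : Ad E a (x - y) = Ad E a x - Ad E a y :=
  map_sub (AdLinear E a) x y

theorem Ad_one (x : E) : Ad E (1 : G) x = x := by
  obtain ⟨c, hc, hc0, rfl⟩ := exists_msmoothCurve_tangent G x
  rw [← tangent_conj hc hc0]
  simp

theorem Ad_mul (a b : G) (x : E) : Ad E (a * b) x = Ad E a (Ad E b x) := by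
  obtain ⟨c, hc, hc0, rfl⟩ := exists_msmoothCurve_tangent G x
  rw [← tangent_conj hc hc0, ← tangent_conj hc hc0, ← tangent_conj (hc.conj b) (by simp [hc0])]
  congr 1
  funext s
  group

theorem Ad_Ad_inv (a : G) (x : E) : Ad E a (Ad E a⁻¹ x) = x := by
  rw [← Ad_mul, mul_inv_cancel, Ad_one]

/-- The vector is a partial derivative of c(r) ℓ(r, τ) c(r)⁻¹, with ℓ the chart line in direction
d(r), which is smooth in both parameters together. -/
theorem MSmoothCurve.smoothCurve_Ad {c : ℝ → G} (hc : MSmoothCurve E c) {d : ℝ → E}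
    (hd : SmoothCurve d) : SmoothCurve fun r => Ad E (c r) (d r) := by
  have h1 : MSmoothOn2 E (fun p : ℝ × ℝ => c p.1 * lineOne E G (d p.1) p.2 * (c p.1)⁻¹) _ :=
    ((hc.msmoothOn2 contDiff_fst _).mul (msmoothOn2_line G hd)).mul
      (hc.msmoothOn2 contDiff_fst _).inv
  exact h1.smoothCurve_tangent (isOpen_line_mem_target E G hd)
    (fun r => chartOne_add_zero_smul_mem _) fun r => by simp [lineOne_zero]

theorem smoothNearOne_Ad (y : E) : SmoothNearOne E fun a : G => Ad E a y := fun _ hq _ =>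
  ⟨univ, isOpen_univ, mem_univ _, fun c hc hcW => (hq c hc hcW).smoothCurve_Ad
    (smoothCurve_const y)⟩

theorem velocity_Ad {c : ℝ → G} (hc : MSmoothCurve E c) (h1 : c 0 = 1) (y : E) :
    velocity (fun s => Ad E (c s) y) 0 = lieBr E G (tangent E c 0) y :=
  (smoothNearOne_Ad y).velocity_comp hc h1

theorem lieBr_add_right (x y z : E) :
    lieBr E G x (y + z) = lieBr E G x y + lieBr E G x z := by
  obtain ⟨c, hc, hc0, rfl⟩ := exists_msmoothCurve_tangent G x
  rw [← velocity_Ad hc hc0, ← velocity_Ad hc hc0, ← velocity_Ad hc hc0,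
    ← velocity_add (hc.smoothCurve_Ad (smoothCurve_const y))
      (hc.smoothCurve_Ad (smoothCurve_const z))]
  simp_rw [Ad_add]

/-- The Lie bracket is antisymmetric: it is the mixed second derivative of the commutator. -/
theorem lieBr_antisymm (x y : E) : lieBr E G x y = -lieBr E G y x := by
  obtain ⟨c, hc, hc0, rfl⟩ := exists_msmoothCurve_tangent G x
  obtain ⟨d, hd, hd0, rfl⟩ := exists_msmoothCurve_tangent G y
  set x := tangent E c 0
  set y := tangent E d 0
  have hq : MSmoothOn2 E (fun p : ℝ × ℝ => c p.1 * d p.2 * (c p.1)⁻¹ * (d p.2)⁻¹) univ :=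
    (((hc.msmoothOn2 contDiff_fst _).mul (hd.msmoothOn2 contDiff_snd _)).mul
      (hc.msmoothOn2 contDiff_fst _).inv).mul (hd.msmoothOn2 contDiff_snd _).inv
  have hsymm := (hq.smoothOn2_chart (chartOne_mem E G)).partial_comm
    (hq.isOpen_inter_source isOpen_univ (chartOne_mem E G)) (a := 0) (b := 0)
    ⟨mem_univ _, by simpa [hc0, hd0] using one_mem_source E G⟩
  have hdi := ConvenientLieGroup.smooth_inv d hd
  have hci := ConvenientLieGroup.smooth_inv c hc
  -- For fixed s the commutator is a conjugate of d times d⁻¹; for fixed t it is c times a conjugate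
  -- of c⁻¹.
  have h1 : ∀ s, velocity (fun t => chartOne E G (c s * d t * (c s)⁻¹ * (d t)⁻¹)) 0 =
      Ad E (c s) y + -y := fun s => by
    have := tangent_mul (hd.conj (c s)) hdi (t := 0) (by simp [hd0]) (by simp [hd0])
    rw [tangent_conj hd hd0, tangent_inv hd hd0] at this
    exact this
  have h2 : ∀ t, velocity (fun s => chartOne E G (c s * d t * (c s)⁻¹ * (d t)⁻¹)) 0 =
      Ad E (d t) (-x) + x := fun t => by
    have := tangent_mul hc (hci.conj (d t)) (t := 0) (by simp [hc0]) (by simp [hc0])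
    rw [tangent_conj hci (by simp [hc0]), tangent_inv hc hc0, add_comm] at this
    refine Eq.trans ?_ this
    simp only [tangent, mul_assoc]
  -- Equality of the mixed derivatives now reads [x, y] = [y, −x].
  simp_rw [h1, h2] at hsymm
  rw [velocity_add (hc.smoothCurve_Ad (smoothCurve_const y)) (smoothCurve_const _),
    velocity_add (hd.smoothCurve_Ad (smoothCurve_const _)) (smoothCurve_const _),
    velocity_const, velocity_const, add_zero, add_zero, velocity_Ad hc hc0,
    velocity_Ad hd hd0] at hsymm
  have h3 := lieBr_add_right (G := G) y x (-x)
  have h4 : lieBr E G y 0 = 0 := by simpa using lieBr_add_right (G := G) y 0 0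
  rw [add_neg_cancel, h4] at h3
  rw [hsymm]
  exact (neg_eq_of_add_eq_zero_right h3.symm).symm

theorem lieBr_zero_right (x : E) : lieBr E G x 0 = 0 := by
  simpa using lieBr_add_right (G := G) x 0 0

theorem lieBr_neg_right (x y : E) : lieBr E G x (-y) = -lieBr E G x y := by
  have h3 := lieBr_add_right (G := G) x y (-y)
  rw [add_neg_cancel, lieBr_zero_right] at h3
  exact (neg_eq_of_add_eq_zero_right h3.symm).symm

theorem lieBr_sub_left (x y z : E) :
    lieBr E G (x - y) z = lieBr E G x z - lieBr E G y z := by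
  rw [lieBr_antisymm, sub_eq_add_neg, lieBr_add_right, lieBr_neg_right,
    lieBr_antisymm x z, lieBr_antisymm y z]
  abel

/-- Ad_a is linear and preserves smooth curves, so it commutes with the derivative defining the
bracket; moreover Ad_a Ad_b = Ad_{aba⁻¹} Ad_a. -/
theorem Ad_lieBr (a : G) (x y : E) :
    Ad E a (lieBr E G x y) = lieBr E G (Ad E a x) (Ad E a y) := by
  obtain ⟨c, hc, hc0, rfl⟩ := exists_msmoothCurve_tangent G x
  have h1 := SmoothCurve.velocity_linearMap (AdLinear E a)
    (fun d hd => (msmoothCurve_const a).smoothCurve_Ad hd)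
    (hc.smoothCurve_Ad (smoothCurve_const y)) 0
  rw [velocity_Ad hc hc0] at h1
  refine h1.symm.trans ?_
  rw [← tangent_conj hc hc0, ← velocity_Ad (hc.conj a) (by simp [hc0])]
  congr 1
  funext s
  change Ad E a (Ad E (c s) y) = _
  rw [← Ad_mul, ← Ad_mul]
  simp

theorem SmoothCurve.lieBr {d : ℝ → E} (hd : SmoothCurve d) (y : E) :
    SmoothCurve fun r => lieBr E G (d r) y := by
  have h1 : SmoothOn2 (fun p : ℝ × ℝ => Ad E (lineOne E G (d p.1) p.2) y)
      {p : ℝ × ℝ | chartOne E G 1 + p.2 • d p.1 ∈ (chartOne E G).target} := fun c hc hcW =>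
    (msmoothOn2_line G hd c hc hcW).smoothCurve_Ad (smoothCurve_const y)
  exact (h1.partialSnd (isOpen_line_mem_target E G hd)) (fun r => (r, 0))
    (contDiff_id.prodMk contDiff_const) fun r => chartOne_add_zero_smul_mem _

end Adjoint

/-! ### Logarithmic derivatives, uniqueness, and one-parameter subgroups. -/

section LogarithmicDerivative

variable {E : Type*} [AddCommGroup E] [Module ℝ E] [TopologicalSpace E] [ConvenientSpace E]
  {G : Type*} [Group G] [ConvenientLieGroup E G]

theorem logDeriv_eq_tangent {γ : ℝ → G} (hγ : MSmoothCurve E γ) (t : ℝ) :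
    logDeriv E γ t = tangent E (fun s => (γ t)⁻¹ * γ (t + s)) 0 :=
  (tangent_shift (hγ.const_mul (γ t)⁻¹) (by simp)).symm

theorem MSmoothCurve.left_translate {γ : ℝ → G} (hγ : MSmoothCurve E γ) (t : ℝ) :
    MSmoothCurve E fun s => (γ t)⁻¹ * γ (t + s) :=
  (hγ.comp (contDiff_const.add contDiff_id)).const_mul _

/-- Smoothness jointly in time and in the variation parameter is what allows differentiating the
energy under the integral. -/
theorem MSmoothOn2.logDeriv {Q : ℝ × ℝ → G} (hQ : MSmoothOn2 E Q univ) :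
    SmoothOn2 (fun p => logDeriv E (fun t => Q (t, p.2)) p.1) univ := by
  intro c hc _
  have h1 : MSmoothOn2 E (fun p : ℝ × ℝ => (Q (c p.1))⁻¹ * Q ((c p.1).1 + p.2, (c p.1).2)) univ := by
    have hc1 : ContDiff ℝ ∞ fun p : ℝ × ℝ => c p.1 := hc.comp contDiff_fst
    exact (hQ.comp hc1 fun _ _ => mem_univ _).inv.mul
      (hQ.comp ((hc1.fst.add contDiff_snd).prodMk hc1.snd) fun _ _ => mem_univ _)
  have h2 := h1.smoothCurve_tangent isOpen_univ (fun _ => mem_univ _) fun r => by simp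
  convert h2 using 2 with r
  exact logDeriv_eq_tangent (hQ (fun t => (t, (c r).2)) (contDiff_id.prodMk contDiff_const)
    fun _ => mem_univ _) _

theorem MSmoothCurve.logDeriv {γ : ℝ → G} (hγ : MSmoothCurve E γ) :
    SmoothCurve (logDeriv E γ) :=
  (MSmoothOn2.logDeriv (hγ.msmoothOn2 contDiff_fst univ)) (fun t => (t, 0))
    (contDiff_id.prodMk contDiff_const) fun _ => mem_univ _

theorem logDeriv_const (a : G) (t : ℝ) : logDeriv E (fun _ => a) t = 0 := by
  have := tangent_const (E := E) (G := G) t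
  simpa [ConvLie.logDeriv, tangent] using this

theorem logDeriv_mul {γ δ : ℝ → G} (hγ : MSmoothCurve E γ) (hδ : MSmoothCurve E δ) (t : ℝ) :
    logDeriv E (fun s => γ s * δ s) t = Ad E (δ t)⁻¹ (logDeriv E γ t) + logDeriv E δ t := by
  rw [logDeriv_eq_tangent (ConvenientLieGroup.smooth_mul _ _ hγ hδ), logDeriv_eq_tangent hγ,
    logDeriv_eq_tangent hδ, ← tangent_conj (hγ.left_translate t) (by simp),
    ← tangent_mul ((hγ.left_translate t).conj _) (hδ.left_translate t) (by simp) (by simp)]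
  congr 1
  funext s
  group

theorem logDeriv_const_mul (a : G) (γ : ℝ → G) (t : ℝ) :
    logDeriv E (fun s => a * γ s) t = logDeriv E γ t := by
  simp only [logDeriv, mul_inv_rev, mul_assoc, inv_mul_cancel_left]

theorem logDeriv_comp {γ : ℝ → G} (hγ : MSmoothCurve E γ) {h : ℝ → ℝ} (hh : ContDiff ℝ ∞ h)
    (t : ℝ) : logDeriv E (fun s => γ (h s)) t = deriv h t • logDeriv E γ (h t) := by
  have hk : ContDiff ℝ ∞ fun s => h (t + s) - h t :=
    (hh.comp (contDiff_const.add contDiff_id)).sub contDiff_const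
  have hd : HasDerivAt (fun s => h (t + s) - h t) (deriv h t) 0 := by
    have h1 : HasDerivAt h (deriv h t) (t + 0) := by
      rw [add_zero]
      exact (hh.differentiable (by simp) t).hasDerivAt
    exact (h1.comp_const_add t 0).sub_const _
  rw [logDeriv_eq_tangent (hγ.comp hh), logDeriv_eq_tangent hγ,
    ← tangent_comp (hγ.left_translate (h t)) (by simp) hk (by simp) hd]
  simp

/-- The chart around γ(t) is unrelated to `chartOne`; writing γ as γ(t) times its left translate,
the chain rule at 1 carries the vanishing over to ψ. -/
theorem velocity_chart_eq_zero {γ : ℝ → G} (hγ : MSmoothCurve E γ) {t : ℝ}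
    (h0 : logDeriv E γ t = 0) {ψ : PartialEquiv G E}
    (hψ : ψ ∈ ConvenientManifold.atlas (E := E) (M := G)) (ht : γ t ∈ ψ.source) {d : ℝ → E}
    (hd : SmoothCurve d) (hdγ : d =ᶠ[𝓝 t] fun s => ψ (γ s)) : velocity d t = 0 := by
  have h1 := (smoothNearOne_chart_comp (E := E) (g := fun b : G => γ t * b)
    (fun _ hc => hc.const_mul _) hψ (by simpa using ht)).velocity_comp
      (hγ.left_translate t) (by simp)
  rw [← logDeriv_eq_tangent hγ, h0] at h1
  have h2 : ∀ s, lineOne E G (0 : E) s = 1 := fun s => by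
    simp [lineOne, (chartOne E G).left_inv (one_mem_source E G)]
  simp only [h2, velocity_const, mul_inv_cancel_left] at h1
  rw [← h1, ← (hd.hasVelocityAt t).hasVelocityAt_shift.velocity_eq]
  refine velocity_congr ?_
  have h3 : Tendsto (fun s => t + s) (𝓝 (0 : ℝ)) (𝓝 t) := by
    have : Tendsto (fun s => t + s) (𝓝 (0 : ℝ)) (𝓝 (t + 0)) :=
      Continuous.tendsto (by fun_prop) 0
    rwa [add_zero] at this
  exact h3.eventually hdγ

/-- In charts the velocity vanishes, so the curve is locally constant, and ℝ is connected. -/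
theorem eq_of_logDeriv_eq_zero {γ : ℝ → G} (hγ : MSmoothCurve E γ)
    (h0 : ∀ t, logDeriv E γ t = 0) (t : ℝ) : γ t = γ 0 := by
  refine IsLocallyConstant.apply_eq_of_preconnectedSpace
    ((IsLocallyConstant.iff_eventually_eq γ).2 fun t => ?_) t 0
  obtain ⟨ψ, hψ, d, hd, hdt, hcd⟩ := hγ.exists_chart t
  obtain ⟨r, hr, hball⟩ := Metric.eventually_nhds_iff_ball.1 hcd
  have hv : ∀ s ∈ Metric.ball t r, velocity d s = 0 := fun s hs => by
    refine velocity_chart_eq_zero hγ (h0 s) hψ ?_ hd ?_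
    · rw [hball s hs]; exact ψ.map_target (hdt s)
    · filter_upwards [Metric.isOpen_ball.mem_nhds hs] with s' hs'
      rw [hball s' hs', ψ.right_inv (hdt s')]
  filter_upwards [Metric.ball_mem_nhds t hr] with s hs
  rw [hball s hs, hball t (Metric.mem_ball_self hr)]
  refine congrArg ψ.symm (eq_of_functionals fun l => ?_)
  refine Metric.isOpen_ball.is_const_of_deriv_eq_zero (f := fun s => l (d s))
    (convex_ball t r).isPreconnected
    ((hd.contDiff l).differentiable (by simp)).differentiableOn (fun s hs => ?_) hs
    (Metric.mem_ball_self hr)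
  rw [hd.deriv_apply, hv s hs, map_zero]
  rfl

/-- A smooth curve is determined by its initial point and its left logarithmic derivative. -/
theorem eq_of_logDeriv_eq {γ δ : ℝ → G} (hγ : MSmoothCurve E γ) (hδ : MSmoothCurve E δ)
    (h0 : γ 0 = δ 0) (h : ∀ t, logDeriv E γ t = logDeriv E δ t) (t : ℝ) : γ t = δ t := by
  have hδi := ConvenientLieGroup.smooth_inv δ hδ
  have h1 := eq_of_logDeriv_eq_zero (ConvenientLieGroup.smooth_mul _ _ hγ hδi) (fun t => by
    have h2 := logDeriv_mul hδ hδi t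
    simp only [mul_inv_cancel, logDeriv_const] at h2
    rw [logDeriv_mul hγ hδi, h t, ← h2]) t
  rw [h0, mul_inv_cancel, mul_inv_eq_one] at h1
  exact h1

/-- The curve s ↦ δ(ts) has constant logarithmic derivative t x; uniqueness identifies it with the
one chosen in `expG`, evaluated at s = 1. -/
theorem expG_smul_of_logDeriv {δ : ℝ → G} (hδ : MSmoothCurve E δ) (h0 : δ 0 = 1) {x : E}
    (h : ∀ t, logDeriv E δ t = x) (t : ℝ) : expG E (t • x) = δ t := by
  have hh : ContDiff ℝ ∞ fun s : ℝ => t * s := contDiff_const.mul contDiff_id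
  have h1 : ∀ s, logDeriv E (fun s => δ (t * s)) s = t • x := fun s => by
    have hd : deriv (fun s : ℝ => t * s) s = t := by
      simp
    rw [logDeriv_comp hδ hh, h, hd]
  have hex : ∃ γ : ℝ → G, MSmoothCurve E γ ∧ γ 0 = 1 ∧ ∀ s, logDeriv E γ s = t • x :=
    ⟨fun s => δ (t * s), hδ.comp hh, by simp [h0], h1⟩
  have hs := hex.choose_spec
  rw [expG, dif_pos hex, eq_of_logDeriv_eq hs.1 (hδ.comp hh) (by simp [hs.2.1, h0])
    (fun s => by rw [hs.2.2, h1]), mul_one]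

/-- Both δ(s)⁻¹ δ(s + ·) and δ start at 1 with logarithmic derivative x. -/
theorem map_add_of_logDeriv {δ : ℝ → G} (hδ : MSmoothCurve E δ) (h0 : δ 0 = 1) {x : E}
    (h : ∀ t, logDeriv E δ t = x) (s t : ℝ) : δ (s + t) = δ s * δ t := by
  have h1 := eq_of_logDeriv_eq (hδ.left_translate s) hδ (by simp [h0]) (fun t => by
    rw [logDeriv_const_mul, logDeriv_comp hδ (h := fun t => s + t)
      (contDiff_const.add contDiff_id), h, h,
      show deriv (fun t : ℝ => s + t) t = 1 by simp, one_smul]) t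
  rw [← h1]
  simp

variable {F : Type*} [AddCommGroup F] [Module ℝ F] [TopologicalSpace F] [ConvenientSpace F]
  {K : Type*} [Group K] [ConvenientLieGroup F K]

theorem IsLieSubgroup.tangentOne_tangent {ι : K →* G} (hι : IsLieSubgroup E F ι) {c : ℝ → K}
    (hc : MSmoothCurve F c) (h1 : c 0 = 1) :
    tangentOne E F ι (tangent F c 0) = tangent E (fun s => ι (c s)) 0 :=
  ((smoothNearOne_chart_comp (E := F) (g := ι) hι.smooth (chartOne_mem E G)
    (by simpa using one_mem_source E G)).velocity_comp hc h1).symm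

theorem IsLieSubgroup.logDeriv_comp {ι : K →* G} (hι : IsLieSubgroup E F ι) {κ : ℝ → K}
    (hκ : MSmoothCurve F κ) (t : ℝ) :
    logDeriv E (fun s => ι (κ s)) t = tangentOne E F ι (logDeriv F κ t) := by
  rw [logDeriv_eq_tangent (hι.smooth κ hκ), logDeriv_eq_tangent hκ,
    hι.tangentOne_tangent (hκ.left_translate t) (by simp)]
  simp

theorem IsLieSubgroup.Ad_tangentOne {ι : K →* G} (hι : IsLieSubgroup E F ι) (a : K) (y : F) :
    Ad E (ι a) (tangentOne E F ι y) = tangentOne E F ι (Ad F a y) := by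
  obtain ⟨c, hc, hc0, rfl⟩ := exists_msmoothCurve_tangent K y
  rw [hι.tangentOne_tangent hc hc0, ← tangent_conj hc hc0,
    hι.tangentOne_tangent (hc.conj a) (by simp [hc0]),
    ← tangent_conj (hι.smooth c hc) (by simp [hc0])]
  simp

end LogarithmicDerivative

/-! ### First variation of the energy and the Euler–Arnold equation. -/

section EulerArnold

variable {E : Type*} [AddCommGroup E] [Module ℝ E] [TopologicalSpace E] [ConvenientSpace E]
  {G : Type*} [Group G] [ConvenientLieGroup E G]

theorem lieBr_smul_right (r : ℝ) (x y : E) : lieBr E G x (r • y) = r • lieBr E G x y := by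
  obtain ⟨c, hc, hc0, rfl⟩ := exists_msmoothCurve_tangent G x
  rw [← velocity_Ad hc hc0, ← velocity_Ad hc hc0]
  simp_rw [Ad_smul]
  rw [velocity_smul (hc.smoothCurve_Ad (smoothCurve_const y)) contDiff_const]
  simp

/-- Product rule for a smooth bilinear form. -/
theorem IsInner.hasDerivAt {B : LinearMap.BilinForm ℝ E} (hB : IsInner B) {c d : ℝ → E}
    (hc : SmoothCurve c) (hd : SmoothCurve d) (t : ℝ) :
    HasDerivAt (fun s => B (c s) (d s)) (B (velocity c t) (d t) + B (c t) (velocity d t)) t := by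
  -- Only the action of `B` on smooth curves is known, so the product rule comes from Hadamard
  -- expansions of both arguments instead of joint continuity.
  obtain ⟨e, he, hce, he0⟩ := hc.hadamard t
  obtain ⟨f, hf, hdf, hf0⟩ := hd.hadamard t
  have h1 : (fun s => B (c s) (d s)) = fun s =>
      B (c t) (d t) + (s - t) * (B (e s) (d s) + B (c t) (f s)) := by
    funext s
    have h2 : B (c s) (d s) = B (c t) (d s) + (s - t) * B (e s) (d s) := by
      conv_lhs => rw [hce s]
      simp
    have h3 : B (c t) (d s) = B (c t) (d t) + (s - t) * B (c t) (f s) := by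
      conv_lhs => rw [hdf s]
      simp
    rw [h2, h3]
    ring
  have h4 : ContDiff ℝ ∞ fun s => B (e s) (d s) + B (c t) (f s) :=
    (hB.smooth e d he hd).add (hB.smooth _ f (smoothCurve_const _) hf)
  have h5 := ((hasDerivAt_id t).sub_const t).mul (h4.differentiable (by simp) t).hasDerivAt
  rw [h1, ← he0, ← hf0]
  have h6 := h5.const_add (B (c t) (d t))
  simp only [id_eq, one_mul, sub_self, zero_mul, add_zero] at h6
  exact h6

theorem IsInner.eq_of_forall {B : LinearMap.BilinForm ℝ E} (hB : IsInner B) {x y : E}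
    (h : ∀ z, B x z = B y z) : x = y := by
  by_contra hne
  have h1 := hB.pos (x - y) (sub_ne_zero.2 hne)
  rw [map_sub (B (x - y)), map_sub B, LinearMap.sub_apply, LinearMap.sub_apply, h, h] at h1
  simp at h1

/-- The variation `γ(t) σ(s χ(t))`. -/
theorem isVariation_mul {γ σ : ℝ → G} (hγ : MSmoothCurve E γ) (hσ : MSmoothCurve E σ)
    (hσ0 : σ 0 = 1) {χ : ℝ → ℝ} (hχ : ContDiff ℝ ∞ χ) (h0 : χ 0 = 0) (h1 : χ 1 = 0) :
    IsVariation E γ 1 fun t s => γ t * σ (s * χ t) where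
  smooth a b ha hb _ := ConvenientLieGroup.smooth_mul _ _ (hγ.comp ha)
    (hσ.comp (hb.mul (hχ.comp ha)))
  base t _ := by simp [hσ0]
  left s _ := by simp [hσ0, h0]
  right s _ := by simp [hσ0, h1]

theorem logDeriv_variation {γ σ : ℝ → G} (hγ : MSmoothCurve E γ) (hσ : MSmoothCurve E σ)
    {χ : ℝ → ℝ} (hχ : ContDiff ℝ ∞ χ) (s t : ℝ) :
    logDeriv E (fun t => γ t * σ (s * χ t)) t =
      Ad E (σ (s * χ t))⁻¹ (logDeriv E γ t) + (s * deriv χ t) • logDeriv E σ (s * χ t) := by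
  have hs : ContDiff ℝ ∞ fun t => s * χ t := contDiff_const.mul hχ
  have hd : deriv (fun t => s * χ t) t = s * deriv χ t :=
    ((hχ.differentiable (by simp) t).hasDerivAt.const_mul s).deriv
  rw [logDeriv_mul hγ (hσ.comp hs), logDeriv_comp hσ hs, hd]

/-- With y the tangent of σ and u that of γ, differentiating Ad of the inverse gives −χ[y, u] = χ[u,
y]. In the other term the factor s kills the derivative of `logDeriv E σ` at s = 0, leaving χ' y. -/
theorem velocity_logDeriv_variation {γ σ : ℝ → G} (hγ : MSmoothCurve E γ)
    (hσ : MSmoothCurve E σ) (hσ0 : σ 0 = 1) {χ : ℝ → ℝ} (hχ : ContDiff ℝ ∞ χ) (t : ℝ) :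
    velocity (fun s => logDeriv E (fun t => γ t * σ (s * χ t)) t) 0 =
      χ t • lieBr E G (logDeriv E γ t) (tangent E σ 0) + deriv χ t • tangent E σ 0 := by
  simp_rw [logDeriv_variation hγ hσ hχ]
  have hh : ContDiff ℝ ∞ fun s : ℝ => s * χ t := contDiff_id.mul contDiff_const
  have hk : ContDiff ℝ ∞ fun s : ℝ => s * deriv χ t := contDiff_id.mul contDiff_const
  have hd : ∀ a : ℝ, HasDerivAt (fun s : ℝ => s * a) a 0 := fun a => by
    simpa using (hasDerivAt_id (0 : ℝ)).mul_const a
  have hi := ConvenientLieGroup.smooth_inv _ (hσ.comp hh)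
  have h1 : logDeriv E σ 0 = tangent E σ 0 := by
    simp only [logDeriv, hσ0, inv_one, one_mul]
    rfl
  rw [velocity_add (hi.smoothCurve_Ad (smoothCurve_const _)) ((hσ.logDeriv.comp hh).smul hk),
    velocity_Ad hi (by simp [hσ0]), tangent_inv (hσ.comp hh) (by simp [hσ0]),
    tangent_comp hσ hσ0 hh (by simp) (hd _), velocity_smul (hσ.logDeriv.comp hh) hk,
    (hd (deriv χ t)).deriv, zero_mul, zero_mul, zero_smul, add_zero, h1, lieBr_antisymm,
    lieBr_neg_right, lieBr_smul_right, neg_neg]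

/-- The first variation of the energy. -/
theorem IsRiemannianGeodesic.first_variation {B : LinearMap.BilinForm ℝ E} (hB : IsInner B)
    {γ : ℝ → G} (hγ : IsRiemannianGeodesic B γ) (y : E) {χ : ℝ → ℝ} (hχ : ContDiff ℝ ∞ χ)
    (h0 : χ 0 = 0) (h1 : χ 1 = 0) :
    ∫ t in (0 : ℝ)..1, (χ t * B (logDeriv E γ t) (lieBr E G (logDeriv E γ t) y) +
      deriv χ t * B (logDeriv E γ t) y) = 0 := by
  obtain ⟨σ, hσ, hσ0, rfl⟩ := exists_msmoothCurve_tangent G y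
  set U : ℝ × ℝ → E := fun p => logDeriv E (fun t => γ t * σ (p.2 * χ t)) p.1 with hU
  have hUs : SmoothOn2 U univ := MSmoothOn2.logDeriv
    (Q := fun p : ℝ × ℝ => γ p.1 * σ (p.2 * χ p.1))
    ((hγ.smooth.msmoothOn2 contDiff_fst _).mul
      (hσ.msmoothOn2 (contDiff_snd.mul (hχ.comp contDiff_fst)) _))
  -- Boman's theorem makes the energy density an ordinary smooth function of (t, s).
  have hb : ContDiff ℝ ∞ fun p => B (U p) (U p) :=
    contDiffOn_univ.1 (contDiffOn_of_smooth_along_curves isOpen_univ fun c hc hcW =>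
      hB.smooth _ _ (hUs c hc hcW) (hUs c hc hcW))
  have hE := (hasDerivAt_integral_of_contDiff hb 0).const_mul (1 / 2 : ℝ)
  have hcrit := hγ.critical 1 one_pos _ (isVariation_mul hγ.smooth hσ hσ0 hχ h0 h1)
  have h2 := hcrit.unique hE
  rw [← intervalIntegral.integral_const_mul] at h2
  refine Eq.trans (intervalIntegral.integral_congr fun t _ => ?_) h2.symm
  have hUt : SmoothCurve fun s => U (t, s) :=
    hUs _ (contDiff_const.prodMk contDiff_id) fun _ => mem_univ _
  have h3 : HasDerivAt (fun s => B (U (t, s)) (U (t, s)))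
      (fderiv ℝ (fun p => B (U p) (U p)) (t, 0) (0, 1)) 0 :=
    HasFDerivAt.comp_hasDerivAt (0 : ℝ) (hb.differentiable (by simp) (t, 0)).hasFDerivAt
      ((hasDerivAt_const (0 : ℝ) t).prodMk (hasDerivAt_id (0 : ℝ)))
  have h4 : velocity (fun s => U (t, s)) 0 = _ :=
    velocity_logDeriv_variation hγ.smooth hσ hσ0 hχ t
  have h5 : U (t, 0) = logDeriv E γ t := by simp [hU, hσ0]
  have h6 := h3.unique (hB.hasDerivAt hUt hUt 0)
  simp only [h6, h4, h5]
  rw [hB.symm _ (logDeriv E γ t)]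
  simp only [map_add, map_smul, smul_eq_mul]
  ring

/-- The Euler–Arnold equation of a Riemannian geodesic. -/
theorem IsRiemannianGeodesic.euler_arnold {B : LinearMap.BilinForm ℝ E} (hB : IsInner B)
    {γ : ℝ → G} (hγ : IsRiemannianGeodesic B γ) {t : ℝ} (ht : t ∈ Icc (0 : ℝ) 1) (y : E) :
    B (velocity (logDeriv E γ) t) y = B (logDeriv E γ t) (lieBr E G (logDeriv E γ t) y) := by
  have hu := hγ.smooth.logDeriv
  set u := logDeriv E γ
  set f : ℝ → ℝ := fun t => B (u t) y with hf
  set g : ℝ → ℝ := fun t => B (u t) (lieBr E G (u t) y) with hg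
  have hfs : ContDiff ℝ ∞ f := hB.smooth _ _ hu (smoothCurve_const y)
  have hgs : ContDiff ℝ ∞ g := hB.smooth _ _ hu (hu.lieBr y)
  have hf' : deriv f t = B (velocity u t) y := by
    have := (hB.hasDerivAt hu (smoothCurve_const y) t).deriv
    rwa [velocity_const, map_zero, add_zero] at this
  have hfc : Continuous (deriv f) := hfs.continuous_deriv (by simp)
  have hgf : Continuous fun t => g t - deriv f t := hgs.continuous.sub hfc
  suffices h : EqOn (fun t => g t - deriv f t) 0 (Icc 0 1) by
    rw [← hf']
    exact (sub_eq_zero.1 (h ht)).symm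
  -- Fundamental lemma of the calculus of variations: test functions supported in (0, 1) vanish at
  -- the end points, and integration by parts takes the derivative off χ.
  have hae := isOpen_Ioo.ae_eq_zero_of_integral_contDiff_smul_eq_zero (U := Ioo (0 : ℝ) 1)
    (μ := MeasureTheory.volume) (f := fun t => g t - deriv f t)
    (hgf.locallyIntegrable.locallyIntegrableOn _) fun χ hχ _ hχs => by
      have h0 : χ 0 = 0 := by
        by_contra h
        exact lt_irrefl _ (hχs (subset_tsupport _ h)).1
      have h1 : χ 1 = 0 := by
        by_contra h
        exact lt_irrefl _ (hχs (subset_tsupport _ h)).2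
      have hχc : Continuous (deriv χ) := hχ.continuous_deriv (by simp)
      have h2 := hγ.first_variation hB y hχ h0 h1
      have h3 : ∫ t in (0 : ℝ)..1, (deriv χ t * f t + χ t * deriv f t) = 0 := by
        rw [intervalIntegral.integral_deriv_mul_eq_sub
          (fun t _ => (hχ.differentiable (by simp) t).hasDerivAt)
          (fun t _ => (hfs.differentiable (by simp) t).hasDerivAt)
          (hχc.intervalIntegrable _ _) (hfc.intervalIntegrable _ _), h0, h1]
        simp
      rw [← intervalIntegral.integral_eq_integral_of_support_subset (a := 0) (b := 1)
        (fun t ht => Ioo_subset_Ioc_self (hχs (subset_tsupport _ fun h => ht (by simp [h]))))]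
      have h4 : ∀ t, χ t • (g t - deriv f t) =
          (χ t * g t + deriv χ t * f t) - (deriv χ t * f t + χ t * deriv f t) := fun t => by
        rw [smul_eq_mul]; ring
      simp_rw [h4]
      rw [intervalIntegral.integral_sub, h3, sub_zero]
      · exact h2
      · exact ((hχ.continuous.mul hgs.continuous).add
          (hχc.mul hfs.continuous)).intervalIntegrable _ _
      · exact ((hχc.mul hfs.continuous).add
          (hχ.continuous.mul hfc)).intervalIntegrable _ _
  -- Continuity upgrades almost everywhere on (0, 1) to everywhere on [0, 1], end points included.
  refine MeasureTheory.Measure.eqOn_Icc_of_ae_eq (μ := MeasureTheory.volume) zero_ne_one ?_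
    hgf.continuousOn continuousOn_const
  rw [MeasureTheory.restrict_Ioo_eq_restrict_Icc.symm]
  exact (MeasureTheory.ae_restrict_iff' measurableSet_Ioo).2 hae

end EulerArnold

/-! ### Momentum conservation and reduction to sub-Riemannian geodesics. -/

section Reduction

variable {E : Type*} [AddCommGroup E] [Module ℝ E] [TopologicalSpace E] [ConvenientSpace E]
  {G : Type*} [Group G] [ConvenientLieGroup E G]
  {F : Type*} [AddCommGroup F] [Module ℝ F] [TopologicalSpace F] [ConvenientSpace F]
  {K : Type*} [Group K] [ConvenientLieGroup F K]

/-- An `Ad(K)`-invariant form: elements of the Lie algebra of `K` act by skew maps. -/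
theorem lieBr_skew {ι : K →* G} (hι : IsLieSubgroup E F ι) {B : LinearMap.BilinForm ℝ E}
    (hB : IsInner B)
    (hAd : ∀ (a : K) (x y : E), B (Ad E (ι a) x) (Ad E (ι a) y) = B x y) (z : F) (x : E) :
    B x (lieBr E G (tangentOne E F ι z) x) = 0 := by
  obtain ⟨c, hc, hc0, rfl⟩ := exists_msmoothCurve_tangent K z
  have hic := hι.smooth c hc
  have hs := hic.smoothCurve_Ad (smoothCurve_const x)
  have h1 := hB.hasDerivAt hs hs 0
  -- By invariance the differentiated function is the constant B x x, so its derivative 2 B(x, [z,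
  -- x]) is zero.
  simp only [hAd] at h1
  have h2 := h1.unique (hasDerivAt_const (0 : ℝ) (B x x))
  rw [velocity_Ad hic (by simp [hc0]), hc0, map_one, Ad_one, hB.symm _ x,
    ← hι.tangentOne_tangent hc hc0] at h2
  linarith

/-- The `𝔨`-component of the left logarithmic derivative of a geodesic is constant. -/
theorem IsRiemannianGeodesic.momentum_const {ι : K →* G} (hι : IsLieSubgroup E F ι)
    {B : LinearMap.BilinForm ℝ E} (hB : IsInner B)
    (hAd : ∀ (a : K) (x y : E), B (Ad E (ι a) x) (Ad E (ι a) y) = B x y)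
    {γ : ℝ → G} (hγ : IsRiemannianGeodesic B γ) (z : F) {t : ℝ} (ht : t ∈ Icc (0 : ℝ) 1) :
    B (logDeriv E γ t) (tangentOne E F ι z) = B (logDeriv E γ 0) (tangentOne E F ι z) := by
  have hu := hγ.smooth.logDeriv
  have hd : ∀ s ∈ Icc (0 : ℝ) 1,
      HasDerivAt (fun s => B (logDeriv E γ s) (tangentOne E F ι z)) 0 s := fun s hs => by
    have h1 := hB.hasDerivAt hu (smoothCurve_const (tangentOne E F ι z)) s
    rwa [velocity_const, map_zero, add_zero, hγ.euler_arnold hB hs, lieBr_antisymm, map_neg,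
      lieBr_skew hι hB hAd, neg_zero] at h1
  exact constant_of_has_deriv_right_zero
    (fun s hs => (hd s hs).continuousAt.continuousWithinAt)
    (fun s hs => (hd s (Ico_subset_Icc_self hs)).hasDerivWithinAt) t ht

/-- Curves satisfying the normal geodesic equation with momentum `lam ∈ 𝔥^⊥` are normal
geodesics. -/
theorem isNormalGeodesic_of_equation {B : LinearMap.BilinForm ℝ E} (hB : IsInner B)
    {𝔥 : Submodule ℝ E} {γ : ℝ → G} (hγ : MSmoothCurve E γ)
    (hh : ∀ t ∈ Icc (0 : ℝ) 1, logDeriv E γ t ∈ 𝔥) {lam : E} (hlam : ∀ x ∈ 𝔥, B lam x = 0)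
    (heq : ∀ t ∈ Icc (0 : ℝ) 1, ∀ y, B (velocity (logDeriv E γ) t) y =
      B (logDeriv E γ t + lam) (lieBr E G (logDeriv E γ t) y)) :
    IsNormalGeodesic B 𝔥 γ where
  smooth := hγ
  horizontal := hh
  orthogonal x hx hx0 hx1 hτ := by
    have hw : SmoothCurve fun t => logDeriv E γ t + lam := hγ.logDeriv.add (smoothCurve_const lam)
    have hs : ContDiff ℝ ∞ fun t => B (logDeriv E γ t + lam) (x t) := hB.smooth _ _ hw hx
    -- Adding λ costs nothing because τ_u x is horizontal and λ ⊥ 𝔥; with u + λ in place of u the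
    -- equation makes the integrand an exact derivative.
    have h1 : ∀ t ∈ uIcc (0 : ℝ) 1, B (logDeriv E γ t) (tau G (logDeriv E γ) x t) =
        deriv (fun t => B (logDeriv E γ t + lam) (x t)) t := fun t ht => by
      rw [uIcc_of_le zero_le_one] at ht
      rw [(hB.hasDerivAt hw hx t).deriv, velocity_add hγ.logDeriv (smoothCurve_const lam),
        velocity_const, add_zero, heq t ht, ← map_add, add_comm (lieBr E G _ _)]
      have := hlam _ (hτ t ht)
      simp only [tau] at this ⊢
      rw [map_add B, LinearMap.add_apply, this, add_zero]
    rw [intervalIntegral.integral_congr h1, intervalIntegral.integral_deriv_eq_sub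
      (fun t _ => hs.differentiable (by simp) t)
      ((hs.continuous_deriv (by simp)).intervalIntegrable _ _), hx0, hx1]
    simp

/-- The reduction of Riemannian geodesics to normal sub-Riemannian geodesics. -/
theorem isNormalGeodesic_mul_expG [RegularLieGroup F K] {ι : K →* G}
    (hι : IsLieSubgroup E F ι) {𝔨 : Submodule ℝ E}
    (h𝔨 : (𝔨 : Set E) = Set.range (tangentOne E F ι))
    {B : LinearMap.BilinForm ℝ E} (hB : IsInner B)
    (hAd : ∀ (a : K) (x y : E), B (Ad E (ι a) x) (Ad E (ι a) y) = B x y)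
    {adT : E → E → E} (hadT : ∀ x w y : E, B (adT x w) y = B w (lieBr E G x y))
    (hsplit : IsCompl 𝔨 (B.orthogonal 𝔨)) {γR : ℝ → G} (hγR : IsRiemannianGeodesic B γR)
    {lam : E} (hlam : lam = 𝔨.projection (B.orthogonal 𝔨) hsplit (logDeriv E γR 0))
    {γ : ℝ → G} (hγ : ∀ t, γ t = γR t * expG E (-(t • lam))) :
    lam ∈ 𝔨 ∧ IsNormalGeodesic B (B.orthogonal 𝔨) γ ∧ ∀ t ∈ Set.Icc (0 : ℝ) 1,
      HasVelocityAt (logDeriv E γ) (adT (logDeriv E γ t) (logDeriv E γ t + lam)) t := by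
  have hmem : ∀ x, x ∈ 𝔨 ↔ ∃ z, tangentOne E F ι z = x := fun x => by
    rw [← SetLike.mem_coe, h𝔨, Set.mem_range]
  have hlam𝔨 : lam ∈ 𝔨 := by rw [hlam]; exact Submodule.projection_apply_mem _ _
  obtain ⟨z, hz⟩ := (hmem lam).1 hlam𝔨
  -- the one-parameter group `exp (t lam)`, which lies in `K`
  obtain ⟨κ, hκ, hκ0, hκd⟩ := RegularLieGroup.exists_curve (E := F) (G := K) (fun _ => z)
    (smoothCurve_const z)
  set k : ℝ → G := fun t => ι (κ t) with hk
  have hks : MSmoothCurve E k := hι.smooth κ hκ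
  have hk0 : k 0 = 1 := by simp [hk, hκ0]
  have hkd : ∀ t, logDeriv E k t = lam := fun t => by
    rw [hι.logDeriv_comp hκ, hκd, hz]
  have hkadd := map_add_of_logDeriv hks hk0 hkd
  have hkneg : ∀ t, k (-t) = (k t)⁻¹ := fun t =>
    eq_inv_of_mul_eq_one_left (by rw [← hkadd, neg_add_cancel, hk0])
  have hexp : ∀ t, expG E (-(t • lam)) = k (-t) := fun t => by
    rw [← neg_smul]
    exact expG_smul_of_logDeriv hks hk0 hkd (-t)
  have hneg : ContDiff ℝ ∞ fun t : ℝ => -t := contDiff_neg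
  have hk's : MSmoothCurve E fun t => k (-t) := hks.comp hneg
  have hγ' : γ = fun t => γR t * k (-t) := funext fun t => by rw [hγ, hexp]
  have hγs : MSmoothCurve E γ := by
    rw [hγ']; exact ConvenientLieGroup.smooth_mul _ _ hγR.smooth hk's
  -- Since k is a one-parameter group, k(s) k(t)⁻¹ = k(t)⁻¹ k(s); as functions of s the two sides
  -- have logarithmic derivatives Ad_{k(t)} λ and λ at s = t.
  have hAdlam : ∀ t, Ad E (k t) lam = lam := fun t => by
    have h2 := logDeriv_mul hks (msmoothCurve_const (E := E) (k t)⁻¹) t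
    have h3 : logDeriv E (fun s => k s * (k t)⁻¹) t = logDeriv E (fun s => (k t)⁻¹ * k s) t := by
      congr 1
      funext s
      rw [← hkneg, ← hkadd, ← hkadd, add_comm]
    rw [h3, logDeriv_const_mul, logDeriv_const, add_zero, inv_inv, hkd] at h2
    exact h2.symm
  have hu_eq : ∀ t, logDeriv E γ t = Ad E (k t) (logDeriv E γR t - lam) := fun t => by
    rw [hγ', logDeriv_mul hγR.smooth hk's, logDeriv_comp hks hneg, hkd, hkneg, inv_inv, Ad_sub,
      hAdlam, sub_eq_add_neg]
    simp
  have hw_eq : ∀ t, logDeriv E γ t + lam = Ad E (k t) (logDeriv E γR t) := fun t => by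
    rw [hu_eq, Ad_sub, hAdlam, sub_add_cancel]
  have hAdinv : ∀ t x y, B (Ad E (k t) x) y = B x (Ad E (k (-t)) y) := fun t x y => by
    conv_lhs => rw [← Ad_Ad_inv (k t) y]
    rw [hkneg]
    exact hAd _ _ _
  -- the `𝔨`-component of `u` is constant
  have hproj : ∀ t ∈ Set.Icc (0 : ℝ) 1, ∀ z',
      B (logDeriv E γR t - lam) (tangentOne E F ι z') = 0 := by
    intro t ht z'
    -- At time 0 this is the definition of λ as a projection; momentum conservation carries it to
    -- all t in [0, 1].
    have h1 : logDeriv E γR 0 - lam ∈ B.orthogonal 𝔨 := by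
      rw [← Submodule.projection_apply_eq_zero_iff hsplit, map_sub, ← hlam,
        Submodule.projection_apply_of_mem_left hsplit hlam𝔨, sub_self]
    have h2 := LinearMap.BilinForm.mem_orthogonal_iff.1 h1 _ ((hmem _).2 ⟨z', rfl⟩)
    have h3 : B (tangentOne E F ι z') (logDeriv E γR 0 - lam) = 0 := h2
    rw [hB.symm] at h3
    have h4 := hγR.momentum_const hι hB hAd z' ht
    rw [map_sub, LinearMap.sub_apply] at h3 ⊢
    rw [h4]
    exact h3
  have hhor : ∀ t ∈ Set.Icc (0 : ℝ) 1, logDeriv E γ t ∈ B.orthogonal 𝔨 := by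
    intro t ht
    refine LinearMap.BilinForm.mem_orthogonal_iff.2 fun x hx => ?_
    obtain ⟨z', rfl⟩ := (hmem x).1 hx
    change B _ _ = 0
    rw [hB.symm, hu_eq, hAdinv]
    simp only [hk]
    rw [hι.Ad_tangentOne]
    exact hproj t ht _
  have hus := hγs.logDeriv
  have heq : ∀ t ∈ Set.Icc (0 : ℝ) 1, ∀ y, B (velocity (logDeriv E γ) t) y =
      B (logDeriv E γ t + lam) (lieBr E G (logDeriv E γ t) y) := by
    intro t ht y
    have h1 := hB.hasDerivAt (hus.add (smoothCurve_const lam)) (smoothCurve_const y) t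
    rw [velocity_const, map_zero, add_zero] at h1
    -- Invariance moves the group element onto the fixed vector y, so the Euler–Arnold equation for
    -- γ_R can be used inside the product rule.
    have e : (fun s => B (logDeriv E γ s + lam) y) =
        fun s => B (logDeriv E γR s) (Ad E (k (-s)) y) := funext fun s => by rw [hw_eq, hAdinv]
    rw [e] at h1
    have hys : SmoothCurve fun t => Ad E (k (-t)) y := hk's.smoothCurve_Ad (smoothCurve_const y)
    have h2 := h1.unique (hB.hasDerivAt hγR.smooth.logDeriv hys t)
    have h3 : velocity (fun t => Ad E (k (-t)) y) t = -lieBr E G lam (Ad E (k (-t)) y) := by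
      -- The one-parameter group law reduces the derivative at t to the derivative at 0, where Ad
      -- differentiates to the bracket.
      have e : ∀ s, Ad E (k (-(t + s))) y = Ad E (k (-s)) (Ad E (k (-t)) y) := fun s => by
        rw [← Ad_mul, ← hkadd, neg_add_rev]
      rw [← (hys.hasVelocityAt t).hasVelocityAt_shift.velocity_eq]
      simp_rw [e]
      have hd : HasDerivAt (fun s : ℝ => -s) (-1) 0 := hasDerivAt_neg 0
      have h4 : tangent E k 0 = lam := by
        rw [← hkd 0]
        simp only [logDeriv, hk0, inv_one, one_mul]
        rfl
      rw [velocity_Ad hk's (by simp [hk0]), tangent_comp hks hk0 hneg (by simp) hd, h4,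
        neg_one_smul, lieBr_antisymm, lieBr_neg_right, neg_neg, lieBr_antisymm]
    have h5 : velocity (fun s => logDeriv E γ s + lam) t = velocity (logDeriv E γ) t := by
      rw [velocity_add hus (smoothCurve_const lam), velocity_const, add_zero]
    rw [h5, h3, hγR.euler_arnold hB ht, ← map_add,
      ← sub_eq_add_neg, ← lieBr_sub_left] at h2
    rw [h2, hw_eq, hAdinv, Ad_lieBr, hu_eq, ← Ad_mul, ← hkadd, neg_add_cancel, hk0, Ad_one]
  refine ⟨hlam𝔨, isNormalGeodesic_of_equation hB hγs hhor
    (fun x hx => LinearMap.BilinForm.mem_orthogonal_iff.1 hx lam hlam𝔨) heq, fun t ht => ?_⟩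
  -- Positive definiteness turns the equation tested against all y into an equality of vectors.
  have h1 : adT (logDeriv E γ t) (logDeriv E γ t + lam) = velocity (logDeriv E γ) t :=
    hB.eq_of_forall fun y => by rw [hadT, heq t ht]
  rw [h1]
  exact hus.hasVelocityAt t

end Reduction

end ConvLie

theorem mainTheorem3
    {E : Type*} [AddCommGroup E] [Module ℝ E] [TopologicalSpace E] [ConvLie.ConvenientSpace E]
    {G : Type*} [Group G] [ConvLie.ConvenientLieGroup E G] [ConvLie.RegularLieGroup E G]
    {F : Type*} [AddCommGroup F] [Module ℝ F] [TopologicalSpace F] [ConvLie.ConvenientSpace F]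
    {K : Type*} [Group K] [ConvLie.ConvenientLieGroup F K] [ConvLie.RegularLieGroup F K]
    -- `K` is a connected Lie subgroup of `G` with Lie algebra `𝔨`
    (ι : K →* G) (hι : ConvLie.IsLieSubgroup E F ι) (hK : ConvLie.SmoothlyConnected F K)
    (𝔨 : Submodule ℝ E) (h𝔨 : (𝔨 : Set E) = Set.range (ConvLie.tangentOne E F ι))
    -- the `Ad(K)`-invariant inner product on `𝔤`
    (B : LinearMap.BilinForm ℝ E) (hB : ConvLie.IsInner B)
    (hAd : ∀ (a : K) (x y : E), B (ConvLie.Ad E (ι a) x) (ConvLie.Ad E (ι a) y) = B x y)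
    -- the adjoint of `ad_x` exists for all `x`
    (adT : E → E → E) (hadT : ∀ x w y : E, B (adT x w) y = B w (ConvLie.lieBr E G x y))
    -- `𝔤 = 𝔥 ⊕ 𝔨` with `𝔥 = 𝔨^⊥`
    (hsplit : IsCompl 𝔨 (B.orthogonal 𝔨))
    -- a Riemannian geodesic, and `λ = pr_𝔨 κˡ(γ_R'(0))`
    (γR : ℝ → G) (hγR : ConvLie.IsRiemannianGeodesic B γR)
    (lam : E) (hlam : lam = 𝔨.projection (B.orthogonal 𝔨) hsplit (ConvLie.logDeriv E γR 0))
    -- the curve `γ_sR(t) = γ_R(t) exp(-λ t)`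
    (γ : ℝ → G) (hγ : ∀ t, γ t = γR t * ConvLie.expG E (-(t • lam))) :
    lam ∈ 𝔨 ∧
      ConvLie.IsNormalGeodesic B (B.orthogonal 𝔨) γ ∧
      ∀ t ∈ Set.Icc (0 : ℝ) 1,
        ConvLie.HasVelocityAt (ConvLie.logDeriv E γ)
          (adT (ConvLie.logDeriv E γ t) (ConvLie.logDeriv E γ t + lam)) t :=
  ConvLie.isNormalGeodesic_mul_expG hι h𝔨 hB hAd hadT hsplit hγR hlam hγ
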